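/- **Theorem (reciprocal relation for Darcy-type equations).** Let $d\ge 1$ and let $\Omega\subset\mathbb{R}^d$ be an open set with (locally) Lipschitz boundary, with unit outward normal $\widehat{\mathbf n}$ (defined almost everywhere on $\partial\Omega$) and surface measure $\mathrm{d}\Gamma$, the $(d-1)$-dimensional Hausdorff measure on $\partial\Omega$. Let $\partial\Omega=\Gamma^{p}\cup\Gamma^{v}$ with $\Gamma^p,\Gamma^v$ Borel and disjoint. Let $\widetilde\mu_0:\Omega\to(0,\infty)$, and let $\mathbf K(\mathbf x)$, $\mathbf x\in\Omega$, be symmetric $d\times d$ matrices for which there are constants $0<k_1\le k_2$ with $k_1|\boldsymbol\zeta|^2\le \boldsymbol\zeta\cdot\mathbf K(\mathbf x)\boldsymbol\zeta\le k_2|\boldsymbol\zeta|^2$ for all $\mathbf x\in\Omega$, $\boldsymbol\zeta\in\mathbb{R}^d$. Let $r,s\in[1,\infty]$ with $\frac1r+\frac1s=1$ (for instance $r=s=2$). For $i=1,2$ let $(\mathbf v^{(i)},\mathcal P^{(i)})$ be a weak solution of $$\widetilde\mu_0\,\mathbf K^{-1}\mathbf v^{(i)}+\mathrm{grad}\,\mathcal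 P^{(i)}=\mathbf 0,\qquad \mathrm{div}\,\mathbf v^{(i)}=0\qquad\text{in }\Omega,$$ $$\mathcal P^{(i)}=\mathcal P^{(i)}_{\mathrm p}\ \text{ on }\Gamma^p,\qquad \mathbf v^{(i)}\cdot\widehat{\mathbf n}=v_n^{(i)}\ \text{ on }\Gamma^v .$$ That is: $\mathcal P^{(i)}\in H^1(\Omega)$ and $\mathbf v^{(i)}\in L^2(\Omega)^d$; the first equation holds a.e. in $\Omega$ with the weak gradient and the second with the weak divergence; $\mathcal P^{(i)}$ has a trace in $L^{s}(\partial\Omega)$ and $\mathbf v^{(i)}$ has a normal trace $\mathbf v^{(i)}\cdot\widehat{\mathbf n}\in L^{r}(\partial\Omega)$; and the boundary conditions hold a.e. for these traces. Here $g\in L^s(\partial\Omega)$ is the trace of $\mathcal P\in H^1(\Omega)$ if there are compactly supported $u_k\in C^1(\mathbb{R}^d)$ with $u_k\to\mathcal P$ in $H^1(\Omega)$ and $u_k|_{\partial\Omega}\to g$ in $L^s(\partial\Omega)$; and $h\in L^r(\partial\Omega)$ is the normal trace of $\mathbf v$ if there are compactly supported $\mathbf w_k\in C^1(\mathbb{R}^d;\mathbb{R}^d)$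 with $\mathbf w_k\to\mathbf v$ and $\mathrm{div}\,\mathbf w_k\to\mathrm{div}\,\mathbf v$ in $L^2(\Omega)$ and $\mathbf w_k\cdot\widehat{\mathbf n}\to h$ in $L^r(\partial\Omega)$. Then all four integrands below are integrable and $$\int_{\Gamma^{v}} v_n^{(2)}\,\mathcal P^{(1)}\,\mathrm d\Gamma-\int_{\Gamma^{p}}\mathcal P_{\mathrm p}^{(2)}\,\mathbf v^{(1)}\cdot\widehat{\mathbf n}\,\mathrm d\Gamma=\int_{\Gamma^{v}} v_n^{(1)}\,\mathcal P^{(2)}\,\mathrm d\Gamma-\int_{\Gamma^{p}}\mathcal P_{\mathrm p}^{(1)}\,\mathbf v^{(2)}\cdot\widehat{\mathbf n}\,\mathrm d\Gamma ,$$ where $\mathcal P^{(i)}$ and $\mathbf v^{(i)}\cdot\widehat{\mathbf n}$ on the boundary denote the traces. -/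

import Mathlib

open MeasureTheory Filter Topology
open scoped ENNReal NNReal ContDiff InnerProductSpace

/-- Physical space `ℝ^d` with its Euclidean norm and inner product. -/
abbrev Space (d : ℕ) : Type := EuclideanSpace ℝ (Fin d)

/-- Locally Lipschitz boundary: near each boundary point, `Ω` is the set of points lying strictly
below the graph of a Lipschitz function over the hyperplane orthogonal to some unit vector `e`. -/
def HasLipschitzBoundary {d : ℕ} (Ω : Set (Space d)) : Prop :=
  ∀ x ∈ frontier Ω, ∃ e : Space d, ‖e‖ = 1 ∧ ∃ r : ℝ, 0 < r ∧
    ∃ (L : ℝ≥0) (φ : (Submodule.span ℝ {e})ᗮ → ℝ), LipschitzWith L φ ∧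
      ∀ y ∈ Metric.ball x r,
        (y ∈ Ω ↔ ⟪e, y⟫_ℝ < φ ((Submodule.span ℝ {e})ᗮ.orthogonalProjectionOnto y))

/-- The surface measure `dΓ` on `∂Ω`: the `(d-1)`-dimensional Hausdorff measure, normalised to agree
with Lebesgue measure on hyperplanes, restricted to the boundary (used for `d ≥ 1`). -/
noncomputable def surfaceMeasure {d : ℕ} (Ω : Set (Space d)) : Measure (Space d) :=
  (μHE[d - 1] : Measure (Space d)).restrict (frontier Ω)

/-- `ν` is the unit outward normal of `Ω` at `x`: to first order at `x`, the set `Ω` is the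
half-space of points `y` with `⟪ν, y - x⟫ < 0`. There is at most one such `ν`. -/
def IsOutwardUnitNormal {d : ℕ} (Ω : Set (Space d)) (x ν : Space d) : Prop :=
  ‖ν‖ = 1 ∧ ∀ ε : ℝ, 0 < ε → ∀ᶠ y in 𝓝 x,
    (⟪ν, y - x⟫_ℝ < -(ε * ‖y - x‖) → y ∈ Ω) ∧ (ε * ‖y - x‖ < ⟪ν, y - x⟫_ℝ → y ∉ Ω)

open Classical in
/-- The unit outward normal field `n̂` (equal to `0` at points where no normal exists, a null set of
the boundary when the boundary is Lipschitz). -/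
noncomputable def outwardNormal {d : ℕ} (Ω : Set (Space d)) (x : Space d) : Space d :=
  if h : ∃ ν, IsOutwardUnitNormal Ω x ν then h.choose else 0

/-- The classical divergence of a vector field. -/
noncomputable def divergence {d : ℕ} (w : Space d → Space d) (x : Space d) : ℝ :=
  ∑ i : Fin d, (fderiv ℝ w x (EuclideanSpace.single i 1)) i

/-- Test functions: smooth functions with compact support contained in `Ω`. -/
def IsTestFunction {d : ℕ} (Ω : Set (Space d)) (φ : Space d → ℝ) : Prop :=
  ContDiff ℝ ∞ φ ∧ HasCompactSupport φ ∧ tsupport φ ⊆ Ω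

/-- `P ∈ H¹(Ω)` with weak gradient `G`. -/
structure HasWeakGradient {d : ℕ} (Ω : Set (Space d)) (P : Space d → ℝ) (G : Space d → Space d) :
    Prop where
  memLp : MemLp P 2 (volume.restrict Ω)
  memLp_grad : MemLp G 2 (volume.restrict Ω)
  integral_eq : ∀ φ : Space d → ℝ, IsTestFunction Ω φ → ∀ i : Fin d,
    ∫ x in Ω, P x * (gradient φ x) i = -∫ x in Ω, (G x) i * φ x

/-- `v ∈ L²(Ω)^d` with weak divergence `D ∈ L²(Ω)`. -/
structure HasWeakDivergence {d : ℕ} (Ω : Set (Space d)) (v : Space d → Space d) (D : Space d → ℝ) :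
    Prop where
  memLp : MemLp v 2 (volume.restrict Ω)
  memLp_div : MemLp D 2 (volume.restrict Ω)
  integral_eq : ∀ φ : Space d → ℝ, IsTestFunction Ω φ →
    ∫ x in Ω, ⟪v x, gradient φ x⟫_ℝ = -∫ x in Ω, D x * φ x

/-- `g ∈ L^q(∂Ω)` is the trace on `∂Ω` of `P ∈ H¹(Ω)`, whose weak gradient is `G`: there are
compactly supported `C¹` functions on `ℝ^d` that converge to `P` in `H¹(Ω)` and whose restrictions
to the boundary converge to `g` in `L^q(∂Ω)`. -/
def HasTrace {d : ℕ} (Ω : Set (Space d)) (q : ℝ≥0∞) (P : Space d → ℝ) (G : Space d → Space d)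
    (g : Space d → ℝ) : Prop :=
  MemLp g q (surfaceMeasure Ω) ∧
  ∃ u : ℕ → Space d → ℝ, (∀ k, ContDiff ℝ 1 (u k) ∧ HasCompactSupport (u k)) ∧
    Tendsto (fun k => eLpNorm (fun x => u k x - P x) 2 (volume.restrict Ω)) atTop (𝓝 0) ∧
    Tendsto (fun k => eLpNorm (fun x => gradient (u k) x - G x) 2 (volume.restrict Ω))
      atTop (𝓝 0) ∧
    Tendsto (fun k => eLpNorm (fun x => u k x - g x) q (surfaceMeasure Ω)) atTop (𝓝 0)

/-- `h ∈ L^p(∂Ω)` is the normal trace `v • n̂` on `∂Ω` of `v ∈ H(div, Ω)`, whose weak divergence is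
`D`: there are compactly supported `C¹` vector fields on `ℝ^d` that converge to `v` in `H(div, Ω)`
and whose normal components on the boundary converge to `h` in `L^p(∂Ω)`. -/
def HasNormalTrace {d : ℕ} (Ω : Set (Space d)) (p : ℝ≥0∞) (v : Space d → Space d)
    (D : Space d → ℝ) (h : Space d → ℝ) : Prop :=
  MemLp h p (surfaceMeasure Ω) ∧
  ∃ w : ℕ → Space d → Space d, (∀ k, ContDiff ℝ 1 (w k) ∧ HasCompactSupport (w k)) ∧
    Tendsto (fun k => eLpNorm (fun x => w k x - v x) 2 (volume.restrict Ω)) atTop (𝓝 0) ∧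
    Tendsto (fun k => eLpNorm (fun x => divergence (w k) x - D x) 2 (volume.restrict Ω))
      atTop (𝓝 0) ∧
    Tendsto (fun k => eLpNorm (fun x => ⟪w k x, outwardNormal Ω x⟫_ℝ - h x) p (surfaceMeasure Ω))
      atTop (𝓝 0)

/-- The matrix `A` acting on a vector of `ℝ^d`. -/
noncomputable def matAct {d : ℕ} (A : Matrix (Fin d) (Fin d) ℝ) (ζ : Space d) : Space d :=
  Matrix.toEuclideanLin A ζ

/-- A permeability field on `Ω`: symmetric, uniformly elliptic and bounded above. -/
def IsPermeability {d : ℕ} (Ω : Set (Space d)) (K : Space d → Matrix (Fin d) (Fin d) ℝ) : Prop :=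
  (∀ x ∈ Ω, (K x).IsSymm) ∧
  ∃ k₁ k₂ : ℝ, 0 < k₁ ∧ k₁ ≤ k₂ ∧ ∀ x ∈ Ω, ∀ ζ : Space d,
    k₁ * ⟪ζ, ζ⟫_ℝ ≤ ⟪ζ, matAct (K x) ζ⟫_ℝ ∧ ⟪ζ, matAct (K x) ζ⟫_ℝ ≤ k₂ * ⟪ζ, ζ⟫_ℝ

/-- `(v, P)` is a weak solution of
`μ K⁻¹ v + grad P = 0`, `div v = 0` in `Ω`, `P = Pp` on `Γp`, `v • n̂ = vn` on `Γv`,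
where `PB` denotes the boundary values of `P` and `vB` those of `v • n̂`. -/
structure IsDarcySolution {d : ℕ} (Ω Γp Γv : Set (Space d)) (μ : Space d → ℝ)
    (K : Space d → Matrix (Fin d) (Fin d) ℝ) (p q : ℝ≥0∞) (vn Pp : Space d → ℝ)
    (v : Space d → Space d) (P : Space d → ℝ) (vB PB : Space d → ℝ) : Prop where
  momentum : ∃ G : Space d → Space d, HasWeakGradient Ω P G ∧ HasTrace Ω q P G PB ∧
    ∀ᵐ x ∂(volume.restrict Ω), μ x • matAct (K x)⁻¹ (v x) + G x = 0
  div_eq_zero : HasWeakDivergence Ω v (fun _ => 0)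
  normal_trace : HasNormalTrace Ω p v (fun _ => 0) vB
  pressure_bc : ∀ᵐ x ∂((surfaceMeasure Ω).restrict Γp), PB x = Pp x
  velocity_bc : ∀ᵐ x ∂((surfaceMeasure Ω).restrict Γv), vB x = vn x

/-!
The trace `PBᵢ` and the normal trace `vBᵢ` are limits of smooth functions, so Green's formula
`∫_Ω (P div v + ∇P • v) = ∫_∂Ω P (v • n̂)` passes to the limit in the Hölder pairing of `L^q` and
`L^p` (`setIntegral_eq_integral_trace_mul_normalTrace`). With `div vⱼ = 0` and Darcy's law it gives
`∫_∂Ω PBᵢ vBⱼ = ∫_Ω ∇Pᵢ • vⱼ = -∫_Ω μ (K⁻¹ vᵢ) • vⱼ`. Since `K⁻¹` is symmetric, this is symmetric in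
`i` and `j` (`integral_trace_mul_normalTrace_comm`); splitting `∂Ω` into `Γp` and `Γv` and inserting
the boundary conditions gives the reciprocal relation.

What remains is the divergence theorem for `C¹` compactly supported functions on a Lipschitz domain
with the Hausdorff surface measure (`gaussGreen_of_contDiff`). A partition of unity reduces it to a
region `{⟪e, x⟫ < φ}` below a Lipschitz graph, and there it has three ingredients.

* The shear `(y, s) ↦ y + (φ(y) + s) e` preserves volume and straightens the graph. In the direction
  `e` one applies the fundamental theorem of calculus on vertical lines. For a direction `b` tangent
  to `e^⊥`, the function `y ↦ f (y + (φ(y) + s) e)` is Lipschitz with compact support, so its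
  `b`-derivative has integral zero, which exchanges `∂_b f` for `-∂_b φ ∂_e f`. The result is
  `∫ ∂_v f = ∫ f ⟪v, e - ∇φ⟫ dy` (`setIntegral_hypograph_fderiv`).
* The surface measure of the graph is `√(1 + |∇φ|²) dy`, by an area formula
  (`comap_euclideanHausdorffMeasure_eq_withDensity`): by Rademacher's theorem and a countable
  partition, the parametrisation is on each piece close to a linear map `A`, hence changes Hausdorff
  measure by nearly the factor `normDet A`.
* Where `φ` is differentiable, the outward normal is `(e - ∇φ) / √(1 + |∇φ|²)`
  (`isOutwardUnitNormal_graphNormal`), so the density cancels.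
-/

/-! ### The area formula for expanding Lipschitz maps -/

/-- If `g` stretches distances by at most `C` compared with `f`, then `g ∘ f⁻¹` is a well-defined
`C`-Lipschitz map on `f '' s`. -/
theorem euclideanHausdorffMeasure_image_le_of_edist_le {α X Y : Type*}
    [EMetricSpace X] [MeasurableSpace X] [BorelSpace X]
    [EMetricSpace Y] [MeasurableSpace Y] [BorelSpace Y] {f : α → X} {g : α → Y} {s : Set α}
    {C : ℝ≥0} (h : ∀ x ∈ s, ∀ y ∈ s, edist (g x) (g y) ≤ C * edist (f x) (f y)) (n : ℕ) :
    (μHE[n] : Measure Y) (g '' s) ≤ (C : ℝ≥0∞) ^ n * (μHE[n] : Measure X) (f '' s) := by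
  rcases s.eq_empty_or_nonempty with rfl | ⟨x₀, hx₀⟩
  · simp
  have : Nonempty α := ⟨x₀⟩
  have hinv : ∀ x ∈ s, Function.invFunOn f s (f x) ∈ s ∧ f (Function.invFunOn f s (f x)) = f x :=
    fun x hx => ⟨Function.invFunOn_mem ⟨x, hx, rfl⟩, Function.invFunOn_eq ⟨x, hx, rfl⟩⟩
  have hg : ∀ x ∈ s, g (Function.invFunOn f s (f x)) = g x := fun x hx => by
    have := h _ (hinv x hx).1 x hx
    rw [(hinv x hx).2, edist_self, mul_zero] at this
    exact edist_le_zero.1 this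
  have hL : LipschitzOnWith C (g ∘ Function.invFunOn f s) (f '' s) := by
    rintro _ ⟨x, hx, rfl⟩ _ ⟨y, hy, rfl⟩
    simp only [Function.comp]
    rw [hg x hx, hg y hy]
    exact h x hx y hy
  have himg : (g ∘ Function.invFunOn f s) '' (f '' s) = g '' s := by
    rw [Set.image_image]
    exact Set.image_congr fun x hx => hg x hx
  have := hL.hausdorffMeasure_image_le (d := (n : ℝ)) (by positivity)
  rw [himg, ENNReal.rpow_natCast] at this
  simp only [Measure.euclideanHausdorffMeasure_def, Measure.smul_apply, ENNReal.smul_def,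
    smul_eq_mul]
  rw [mul_left_comm]
  gcongr

section Area

variable {V W : Type*} [NormedAddCommGroup V] [InnerProductSpace ℝ V] [FiniteDimensional ℝ V]
  [MeasurableSpace V] [BorelSpace V] [NormedAddCommGroup W] [InnerProductSpace ℝ W]
  [MeasurableSpace W] [BorelSpace W]

open Module

/-- On a set where `g` is close to an expanding linear map `A`, the map `g` distorts Hausdorff
measure by nearly the same factor as `A`, because `g ∘ A⁻¹` is nearly an isometry. -/
theorem image_measure_bounds_of_approximatesLinearOn {A : V →L[ℝ] W} (hA : ∀ v, ‖v‖ ≤ ‖A v‖)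
    {g : V → W} {s : Set V} {δ : ℝ≥0} (hδ : δ < 1) (hg : ApproximatesLinearOn g A s δ) :
    (μHE[finrank ℝ V] : Measure W) (g '' s) ≤ ((1 + δ : ℝ≥0) : ℝ≥0∞) ^ finrank ℝ V *
        (ENNReal.ofReal (A : V →ₗ[ℝ] W).normDet * volume s) ∧
      ENNReal.ofReal (A : V →ₗ[ℝ] W).normDet * volume s ≤
        (((1 - δ)⁻¹ : ℝ≥0) : ℝ≥0∞) ^ finrank ℝ V * (μHE[finrank ℝ V] : Measure W) (g '' s) := by
  have hAs := (A : V →ₗ[ℝ] W).euclideanHausdorffMeasure_image_eq_normDet_mul_volume s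
  have key : ∀ x ∈ s, ∀ y ∈ s, ‖g x - g y - A (x - y)‖ ≤ δ * ‖A (x - y)‖ := fun x hx y hy =>
    (hg x hx y hy).trans (by gcongr; exact hA _)
  rw [← hAs]
  constructor
  · refine euclideanHausdorffMeasure_image_le_of_edist_le (fun x hx y hy => ?_) _
    rw [edist_eq_enorm_sub, edist_eq_enorm_sub, ← enorm_norm (g x - g y)]
    simp only [enorm_eq_nnnorm, nnnorm_norm]
    norm_cast
    rw [← NNReal.coe_le_coe]
    have := norm_le_insert' (g x - g y) (A (x - y))
    have h2 := key x hx y hy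
    simp only [coe_nnnorm, NNReal.coe_mul, NNReal.coe_add, NNReal.coe_one,
      ← map_sub]
    linarith
  · refine euclideanHausdorffMeasure_image_le_of_edist_le (fun x hx y hy => ?_) _
    rw [edist_eq_enorm_sub, edist_eq_enorm_sub, ← enorm_norm (g x - g y)]
    simp only [enorm_eq_nnnorm, nnnorm_norm]
    norm_cast
    rw [← NNReal.coe_le_coe]
    have := norm_le_insert (g x - g y) (A (x - y))
    have h2 := key x hx y hy
    have h3 : (0 : ℝ) < 1 - δ := by have : (δ : ℝ) < 1 := by exact_mod_cast hδ
                                    linarith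
    simp only [coe_nnnorm, NNReal.coe_mul, NNReal.coe_inv, NNReal.coe_sub hδ.le, NNReal.coe_one,
      ← map_sub]
    rw [inv_mul_eq_div, le_div_iff₀ h3]
    linarith

/-- Nearby expanding linear maps have nearly the same `normDet`: compare the measures of the images
of the unit ball. -/
theorem normDet_bounds_of_norm_sub_le {A B : V →L[ℝ] W} (hA : ∀ v, ‖v‖ ≤ ‖A v‖)
    {δ : ℝ≥0} (hδ : δ < 1) (h : ‖B - A‖ ≤ δ) :
    ENNReal.ofReal (B : V →ₗ[ℝ] W).normDet ≤ ((1 + δ : ℝ≥0) : ℝ≥0∞) ^ finrank ℝ V *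
        ENNReal.ofReal (A : V →ₗ[ℝ] W).normDet ∧
      ENNReal.ofReal (A : V →ₗ[ℝ] W).normDet ≤
        (((1 - δ)⁻¹ : ℝ≥0) : ℝ≥0∞) ^ finrank ℝ V * ENNReal.ofReal (B : V →ₗ[ℝ] W).normDet := by
  have hB : ApproximatesLinearOn B A (Metric.ball 0 1) δ := fun x _ y _ => by
    rw [← map_sub, ← sub_apply]
    exact (B - A).le_of_opNorm_le h _
  have h0 : volume (Metric.ball (0 : V) 1) ≠ 0 := (Metric.measure_ball_pos volume _ one_pos).ne'
  have h1 : volume (Metric.ball (0 : V) 1) ≠ ⊤ := measure_ball_lt_top.ne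
  have := image_measure_bounds_of_approximatesLinearOn hA hδ hB
  have hBs := (B : V →ₗ[ℝ] W).euclideanHausdorffMeasure_image_eq_normDet_mul_volume
    (Metric.ball 0 1)
  rw [ContinuousLinearMap.coe_coe] at hBs
  rw [hBs, ← mul_assoc, ← mul_assoc, ENNReal.mul_le_mul_iff_left h0 h1,
    ENNReal.mul_le_mul_iff_left h0 h1] at this
  exact this

variable [FiniteDimensional ℝ W]

theorem measure_le_of_forall_subset_of_cover {α : Type*} [MeasurableSpace α] {μ ν : Measure α}
    {s : Set α} (hs : MeasurableSet s) (t : ℕ → Set α) (ht : ∀ n, MeasurableSet (t n))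
    (hst : s ⊆ ⋃ n, t n)
    (h : ∀ n, ∀ u, MeasurableSet u → u ⊆ s ∩ t n → μ u ≤ ν u) : μ s ≤ ν s := by
  have hd : s = ⋃ n, s ∩ disjointed t n := by
    rw [← Set.inter_iUnion, iUnion_disjointed, Set.inter_eq_left.2 hst]
  have hm : ∀ n, MeasurableSet (s ∩ disjointed t n) := fun n =>
    hs.inter (MeasurableSet.disjointed ht n)
  have hp : Pairwise (Function.onFun Disjoint fun n => s ∩ disjointed t n) := fun i j hij =>
    (disjoint_disjointed t hij).mono Set.inter_subset_right Set.inter_subset_right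
  rw [hd, measure_iUnion hp hm, measure_iUnion hp hm]
  exact ENNReal.tsum_le_tsum fun n => h n _ (hm n)
    (Set.inter_subset_inter_right _ (disjointed_subset t n))

/-- The area formula up to a multiplicative error tending to `1` as `δ → 0`. -/
theorem area_formula_bounds {f : V → W} (hfi : MeasurableEmbedding f)
    (hexp : ∀ x, DifferentiableAt ℝ f x → ∀ v, ‖v‖ ≤ ‖fderiv ℝ f x v‖)
    {s : Set V} (hs : MeasurableSet s) (hd : ∀ x ∈ s, DifferentiableAt ℝ f x)
    {δ : ℝ≥0} (hδ : δ < 1) (hδ0 : 0 < δ) :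
    (μHE[finrank ℝ V] : Measure W) (f '' s) ≤
        ((1 + δ : ℝ≥0) : ℝ≥0∞) ^ finrank ℝ V * (((1 - δ)⁻¹ : ℝ≥0) : ℝ≥0∞) ^ finrank ℝ V *
          ∫⁻ x in s, ENNReal.ofReal (fderiv ℝ f x : V →ₗ[ℝ] W).normDet ∧
      ∫⁻ x in s, ENNReal.ofReal (fderiv ℝ f x : V →ₗ[ℝ] W).normDet ≤
        ((1 + δ : ℝ≥0) : ℝ≥0∞) ^ finrank ℝ V * (((1 - δ)⁻¹ : ℝ≥0) : ℝ≥0∞) ^ finrank ℝ V *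
          (μHE[finrank ℝ V] : Measure W) (f '' s) := by
  set D : ℝ≥0∞ := ((1 + δ : ℝ≥0) : ℝ≥0∞) ^ finrank ℝ V with hD
  set D' : ℝ≥0∞ := (((1 - δ)⁻¹ : ℝ≥0) : ℝ≥0∞) ^ finrank ℝ V with hD'
  set J : V → ℝ≥0∞ := fun x => ENNReal.ofReal (fderiv ℝ f x : V →ₗ[ℝ] W).normDet with hJ
  -- On a piece where both `f` and its derivative are `δ`-close to one linear map.
  have piece : ∀ (A : V →L[ℝ] W) (u : Set V), (∀ v, ‖v‖ ≤ ‖A v‖) → MeasurableSet u →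
      ApproximatesLinearOn f A u δ → (∀ x ∈ u, ‖fderiv ℝ f x - A‖ ≤ δ) →
      (μHE[finrank ℝ V] : Measure W) (f '' u) ≤ D * D' * ∫⁻ x in u, J x ∧
      ∫⁻ x in u, J x ≤ D * D' * (μHE[finrank ℝ V] : Measure W) (f '' u) := by
    intro A u hA hu happ hder
    have h1 := image_measure_bounds_of_approximatesLinearOn hA hδ happ
    have h2 := fun x hx => normDet_bounds_of_norm_sub_le hA hδ (hder x hx)
    constructor
    · refine h1.1.trans ?_
      rw [mul_assoc, ← lintegral_const_mul' _ _ (by simp [hD']), ← setLIntegral_const]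
      exact mul_le_mul_right (setLIntegral_mono' hu fun x hx => (h2 x hx).2) _
    · calc ∫⁻ x in u, J x ≤ ∫⁻ _ in u, D * ENNReal.ofReal (A : V →ₗ[ℝ] W).normDet :=
            setLIntegral_mono' hu fun x hx => (h2 x hx).1
        _ = D * (ENNReal.ofReal (A : V →ₗ[ℝ] W).normDet * volume u) := by
            rw [setLIntegral_const, mul_assoc]
        _ ≤ _ := by rw [mul_assoc]; exact mul_le_mul_right h1.2 _
  set m₁ : Measure V := (μHE[finrank ℝ V] : Measure W).comap f with hm₁
  set m₂ : Measure V := volume.withDensity J with hm₂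
  have e₁ : ∀ u, m₁ u = (μHE[finrank ℝ V] : Measure W) (f '' u) := fun u => hfi.comap_apply _ u
  have e₂ : ∀ u, MeasurableSet u → m₂ u = ∫⁻ x in u, J x := fun u hu => withDensity_apply _ hu
  suffices H : m₁ s ≤ (D * D') • m₂ s ∧ m₂ s ≤ (D * D') • m₁ s by
    simpa [e₁, e₂ s hs] using H
  have key : ∀ u, MeasurableSet u → u ⊆ s →
      (∀ x ∈ u, ∀ y ∈ u, ‖fderiv ℝ f x - fderiv ℝ f y‖ ≤ δ) →
      m₁ u ≤ ((D * D') • m₂) u ∧ m₂ u ≤ ((D * D') • m₁) u := by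
    intro u hu hus hder
    rcases u.eq_empty_or_nonempty with rfl | hne
    · simp
    obtain ⟨t, A, -, htm, hut, happ, hAn⟩ :=
      exists_partition_approximatesLinearOn_of_hasFDerivWithinAt f u (fderiv ℝ f)
        (fun x hx => (hd x (hus hx)).hasFDerivAt.hasFDerivWithinAt) (fun _ => δ)
        (fun _ => hδ0.ne')
    have hpc : ∀ n, ∀ w, MeasurableSet w → w ⊆ u ∩ t n →
        m₁ w ≤ ((D * D') • m₂) w ∧ m₂ w ≤ ((D * D') • m₁) w := by
      intro n w hw hwu
      obtain ⟨y, hy, hAy⟩ := hAn hne n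
      simp only [Measure.smul_apply, smul_eq_mul, e₁, e₂ w hw]
      exact piece (A n) w (hAy ▸ hexp y (hd y (hus hy))) hw ((happ n).mono_set hwu)
        fun x hx => hAy ▸ hder x (hwu hx).1 y hy
    exact ⟨measure_le_of_forall_subset_of_cover hu t htm hut fun n w hw hwu => (hpc n w hw hwu).1,
      measure_le_of_forall_subset_of_cover hu t htm hut fun n w hw hwu => (hpc n w hw hwu).2⟩
  -- Countably many small balls cover the space of linear maps, hence the range of the derivative.
  let q : ℕ → V →L[ℝ] W := TopologicalSpace.denseSeq _
  let t : ℕ → Set V := fun n => fderiv ℝ f ⁻¹' Metric.ball (q n) (δ / 2)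
  have htm : ∀ n, MeasurableSet (t n) := fun n => measurable_fderiv ℝ f measurableSet_ball
  have hst : s ⊆ ⋃ n, t n := fun x _ => by
    obtain ⟨n, hn⟩ := (TopologicalSpace.denseRange_denseSeq (V →L[ℝ] W)).exists_dist_lt
      (fderiv ℝ f x) (half_pos (NNReal.coe_pos.2 hδ0))
    exact Set.mem_iUnion.2 ⟨n, hn⟩
  have hpc : ∀ n, ∀ w, MeasurableSet w → w ⊆ s ∩ t n →
      m₁ w ≤ ((D * D') • m₂) w ∧ m₂ w ≤ ((D * D') • m₁) w := fun n w hw hwt =>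
    key w hw (fun x hx => (hwt hx).1) fun x hx y hy => by
      have h1 : dist (fderiv ℝ f x) (q n) < δ / 2 := (hwt hx).2
      have h2 : dist (fderiv ℝ f y) (q n) < δ / 2 := (hwt hy).2
      rw [← dist_eq_norm]
      linarith [dist_triangle_right (fderiv ℝ f x) (fderiv ℝ f y) (q n)]
  exact ⟨measure_le_of_forall_subset_of_cover hs t htm hst fun n w hw hwu => (hpc n w hw hwu).1,
    measure_le_of_forall_subset_of_cover hs t htm hst fun n w hw hwu => (hpc n w hw hwu).2⟩

/-- The **area formula** for a Lipschitz embedding whose derivative is expanding wherever it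
exists. -/
theorem comap_euclideanHausdorffMeasure_eq_withDensity {f : V → W} {C : ℝ≥0}
    (hf : LipschitzWith C f) (hfi : MeasurableEmbedding f)
    (hexp : ∀ x, DifferentiableAt ℝ f x → ∀ v, ‖v‖ ≤ ‖fderiv ℝ f x v‖) :
    (μHE[finrank ℝ V] : Measure W).comap f =
      volume.withDensity fun x => ENNReal.ofReal (fderiv ℝ f x : V →ₗ[ℝ] W).normDet := by
  set J : V → ℝ≥0∞ := fun x => ENNReal.ofReal (fderiv ℝ f x : V →ₗ[ℝ] W).normDet with hJ
  have hnull : ∀ u : Set V, volume u = 0 → (μHE[finrank ℝ V] : Measure W) (f '' u) = 0 := by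
    intro u hu
    have := euclideanHausdorffMeasure_image_le_of_edist_le (f := (id : V → V)) (g := f) (s := u)
      (fun x _ y _ => hf x y) (finrank ℝ V)
    rw [Set.image_id, InnerProductSpace.euclideanHausdorffMeasure_eq_volume, hu, mul_zero] at this
    exact nonpos_iff_eq_zero.1 this
  have hae : ∀ᵐ x, DifferentiableAt ℝ f x := hf.ae_differentiableAt
  have hmd : MeasurableSet {x | DifferentiableAt ℝ f x} := measurableSet_of_differentiableAt ℝ f
  ext s hs
  rw [hfi.comap_apply, withDensity_apply _ hs]
  set s' := s ∩ {x | DifferentiableAt ℝ f x} with hs'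
  have hss' : volume (s \ s') = 0 := measure_mono_null
    (fun x hx h => hx.2 ⟨hx.1, h⟩) (ae_iff.1 hae)
  have e1 : (μHE[finrank ℝ V] : Measure W) (f '' s) = (μHE[finrank ℝ V] : Measure W) (f '' s') := by
    refine le_antisymm ?_ (measure_mono (Set.image_mono Set.inter_subset_left))
    calc _ ≤ (μHE[finrank ℝ V] : Measure W) (f '' s' ∪ f '' (s \ s')) := by
            rw [← Set.image_union, Set.union_sdiff_cancel Set.inter_subset_left]
      _ ≤ _ := (measure_union_le _ _).trans (by rw [hnull _ hss', add_zero])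
  have e2 : ∫⁻ x in s, J x = ∫⁻ x in s', J x := by
    refine setLIntegral_congr ?_
    exact (ae_eq_set.2 ⟨hss', by simp [hs', Set.sdiff_eq_empty.2 Set.inter_subset_left]⟩)
  rw [e1, e2]
  set n := finrank ℝ V
  have hlim : ∀ a : ℝ≥0∞, Tendsto (fun δ : ℝ≥0 =>
      (((1 + δ : ℝ≥0) : ℝ≥0∞) ^ n * (((1 - δ)⁻¹ : ℝ≥0) : ℝ≥0∞) ^ n) * a) (𝓝[>] 0) (𝓝 a) := by
    intro a
    have hc : Tendsto (fun δ : ℝ≥0 => (1 + δ) ^ n * ((1 - δ)⁻¹) ^ n) (𝓝[>] 0) (𝓝 1) := by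
      have : ContinuousAt (fun δ : ℝ≥0 => (1 + δ) ^ n * ((1 - δ)⁻¹) ^ n) 0 := by
        refine ContinuousAt.mul (by fun_prop) (ContinuousAt.pow (ContinuousAt.inv₀ ?_ (by simp)) n)
        fun_prop
      have h := this.tendsto.mono_left (nhdsWithin_le_nhds (s := Set.Ioi 0))
      simpa using h
    have h2 : Tendsto (fun δ : ℝ≥0 => (((1 + δ) ^ n * ((1 - δ)⁻¹) ^ n : ℝ≥0) : ℝ≥0∞))
        (𝓝[>] 0) (𝓝 ((1 : ℝ≥0) : ℝ≥0∞)) := ENNReal.tendsto_coe.2 hc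
    have h3 := ENNReal.Tendsto.mul_const (b := a) h2 (Or.inl (by simp))
    simpa only [ENNReal.coe_mul, ENNReal.coe_pow, ENNReal.coe_one, one_mul] using h3
  have hev : ∀ᶠ δ : ℝ≥0 in 𝓝[>] 0, 0 < δ ∧ δ < 1 := by
    filter_upwards [self_mem_nhdsWithin, mem_nhdsWithin_of_mem_nhds (Iio_mem_nhds one_pos)]
      with δ h1 h2 using ⟨h1, h2⟩
  refine le_antisymm (ge_of_tendsto (hlim _) ?_) (ge_of_tendsto (hlim _) ?_)
  · filter_upwards [hev] with δ h
    exact (area_formula_bounds hfi hexp (hs.inter hmd) (fun x hx => hx.2) h.2 h.1).1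
  · filter_upwards [hev] with δ h
    exact (area_formula_bounds hfi hexp (hs.inter hmd) (fun x hx => hx.2) h.2 h.1).2

end Area

/-! ### Lipschitz graphs and their surface measure -/

section Graph

open Module

variable {E : Type*} [NormedAddCommGroup E] [InnerProductSpace ℝ E]

/-- The parametrisation `y ↦ y + φ(y) e` of the graph of `φ` over the hyperplane `e^⊥`. -/
def graphMap (e : E) (φ : (ℝ ∙ e)ᗮ → ℝ) (y : (ℝ ∙ e)ᗮ) : E := (y : E) + φ y • e

theorem inner_coe_orthogonal_singleton (e : E) (y : (ℝ ∙ e)ᗮ) : ⟪e, (y : E)⟫_ℝ = 0 :=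
  Submodule.mem_orthogonal_singleton_iff_inner_right.1 y.2

theorem inner_add_smul_self {e : E} (he : ‖e‖ = 1) (y : (ℝ ∙ e)ᗮ) (t : ℝ) :
    ⟪e, (y : E) + t • e⟫_ℝ = t := by
  rw [inner_add_right, inner_coe_orthogonal_singleton, inner_smul_right,
    real_inner_self_eq_norm_sq, he]
  ring

theorem norm_coe_add_smul_sq {e : E} (he : ‖e‖ = 1) (y : (ℝ ∙ e)ᗮ) (t : ℝ) :
    ‖(y : E) + t • e‖ ^ 2 = ‖y‖ ^ 2 + t ^ 2 := by
  rw [norm_add_sq_real, inner_smul_right, real_inner_comm, inner_coe_orthogonal_singleton,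
    norm_smul, he]
  simp

/-- The open set below the graph of `φ` over the hyperplane `e^⊥`. -/
def hypograph (e : E) (φ : (ℝ ∙ e)ᗮ → ℝ) : Set E :=
  {x | ⟪e, x⟫_ℝ < φ ((ℝ ∙ e)ᗮ.orthogonalProjectionOnto x)}

theorem orthogonalProjectionOnto_coe_add_smul (e : E) (y : (ℝ ∙ e)ᗮ) (t : ℝ) :
    (ℝ ∙ e)ᗮ.orthogonalProjectionOnto ((y : E) + t • e) = y := by
  rw [map_add, map_smul, Submodule.orthogonalProjectionOnto_mem_subspace_eq_self,
    Submodule.orthogonalProjectionOnto_orthogonal_apply_eq_zero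
      (Submodule.mem_span_singleton_self e), smul_zero, add_zero]

theorem orthogonalProjectionOnto_add_inner_smul {e : E} (he : ‖e‖ = 1) (x : E) :
    (((ℝ ∙ e)ᗮ.orthogonalProjectionOnto x : (ℝ ∙ e)ᗮ) : E) + ⟪e, x⟫_ℝ • e = x := by
  have h := Submodule.starProjection_add_starProjection_orthogonal (K := ℝ ∙ e) x
  rw [Submodule.starProjection_unit_singleton ℝ he] at h
  rw [add_comm]
  exact h

theorem range_graphMap {e : E} (he : ‖e‖ = 1) (φ : (ℝ ∙ e)ᗮ → ℝ) :
    Set.range (graphMap e φ) =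
      {x | ⟪e, x⟫_ℝ = φ ((ℝ ∙ e)ᗮ.orthogonalProjectionOnto x)} := by
  ext x
  constructor
  · rintro ⟨y, rfl⟩
    simp only [graphMap, Set.mem_ofPred_eq, inner_add_smul_self he,
      orthogonalProjectionOnto_coe_add_smul]
  · intro hx
    exact ⟨_, by rw [graphMap, ← (show _ = _ from hx), orthogonalProjectionOnto_add_inner_smul he]⟩

theorem continuous_graphMap {e : E} {φ : (ℝ ∙ e)ᗮ → ℝ} (hφ : Continuous φ) :
    Continuous (graphMap e φ) := by
  unfold graphMap; fun_prop

theorem lipschitzWith_graphMap {e : E} (he : ‖e‖ = 1) {φ : (ℝ ∙ e)ᗮ → ℝ} {L : ℝ≥0}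
    (hφ : LipschitzWith L φ) : LipschitzWith (1 + L) (graphMap e φ) := by
  refine LipschitzWith.of_dist_le_mul fun y z => ?_
  have h1 : dist (φ y • e) (φ z • e) ≤ L * dist y z := by
    rw [dist_eq_norm, ← sub_smul, norm_smul, he, mul_one, ← dist_eq_norm]
    exact hφ.dist_le_mul y z
  calc dist (graphMap e φ y) (graphMap e φ z) ≤ dist (y : E) z + dist (φ y • e) (φ z • e) :=
        dist_add_add_le _ _ _ _
    _ ≤ dist y z + L * dist y z := by gcongr; exact le_rfl
    _ = ((1 + L : ℝ≥0) : ℝ) * dist y z := by push_cast; ring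

/-- The derivative of `graphMap` at a point where `φ` has derivative `a`. -/
noncomputable def graphDeriv (e : E) (a : (ℝ ∙ e)ᗮ →L[ℝ] ℝ) : (ℝ ∙ e)ᗮ →L[ℝ] E :=
  (ℝ ∙ e)ᗮ.subtypeL + a.smulRight e

theorem graphDeriv_apply (e : E) (a : (ℝ ∙ e)ᗮ →L[ℝ] ℝ) (b : (ℝ ∙ e)ᗮ) :
    graphDeriv e a b = (b : E) + a b • e := rfl

theorem HasFDerivAt.graphMap {e : E} {φ : (ℝ ∙ e)ᗮ → ℝ} {y : (ℝ ∙ e)ᗮ}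
    {a : (ℝ ∙ e)ᗮ →L[ℝ] ℝ} (h : HasFDerivAt φ a y) :
    HasFDerivAt (graphMap e φ) (graphDeriv e a) y :=
  (ℝ ∙ e)ᗮ.subtypeL.hasFDerivAt.add (h.smul_const e)

theorem differentiableAt_graphMap_iff {e : E} (he : ‖e‖ = 1) {φ : (ℝ ∙ e)ᗮ → ℝ} {y : (ℝ ∙ e)ᗮ} :
    DifferentiableAt ℝ (graphMap e φ) y ↔ DifferentiableAt ℝ φ y := by
  refine ⟨fun h => ?_, fun h => h.hasFDerivAt.graphMap.differentiableAt⟩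
  have : φ = fun y => innerSL ℝ e (graphMap e φ y) := by
    ext y
    simp only [innerSL_apply_apply, graphMap, inner_add_smul_self he]
  rw [this]
  exact (innerSL ℝ e).differentiableAt.comp y h

variable [FiniteDimensional ℝ E]

theorem finrank_orthogonal_singleton_eq {e : E} (he : ‖e‖ = 1) :
    finrank ℝ (ℝ ∙ e)ᗮ = finrank ℝ E - 1 := by
  have h0 : e ≠ 0 := fun h => by simp [h] at he
  have := (ℝ ∙ e).finrank_add_finrank_orthogonal
  rw [finrank_span_singleton h0] at this
  omega

/-- The (non-normalised) upward normal `e - ∇φ` of the graph of `φ`. -/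
noncomputable def graphNormal (e : E) (φ : (ℝ ∙ e)ᗮ → ℝ) (y : (ℝ ∙ e)ᗮ) : E :=
  e - (gradient φ y : (ℝ ∙ e)ᗮ)

theorem inner_graphNormal_coe_add_smul {e : E} (he : ‖e‖ = 1) (φ : (ℝ ∙ e)ᗮ → ℝ)
    (y b : (ℝ ∙ e)ᗮ) (t : ℝ) :
    ⟪graphNormal e φ y, (b : E) + t • e⟫_ℝ = t - fderiv ℝ φ y b := by
  have h1 : ⟪((gradient φ y : (ℝ ∙ e)ᗮ) : E), (b : E)⟫_ℝ = fderiv ℝ φ y b := by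
    rw [← Submodule.coe_inner, inner_gradient_left]
  have h2 : ⟪((gradient φ y : (ℝ ∙ e)ᗮ) : E), e⟫_ℝ = 0 := by
    rw [real_inner_comm, inner_coe_orthogonal_singleton]
  rw [graphNormal, inner_sub_left, inner_add_smul_self he, inner_add_right, inner_smul_right,
    h1, h2]
  ring

theorem norm_graphNormal_sq {e : E} (he : ‖e‖ = 1) (φ : (ℝ ∙ e)ᗮ → ℝ) (y : (ℝ ∙ e)ᗮ) :
    ‖graphNormal e φ y‖ ^ 2 = 1 + fderiv ℝ φ y (gradient φ y) := by
  have h := norm_coe_add_smul_sq he (-(gradient φ y)) 1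
  have h2 : fderiv ℝ φ y (gradient φ y) = ‖gradient φ y‖ ^ 2 := by
    rw [← inner_gradient_left, real_inner_self_eq_norm_sq]
  have h3 : graphNormal e φ y = ((-(gradient φ y) : (ℝ ∙ e)ᗮ) : E) + (1 : ℝ) • e := by
    rw [graphNormal, one_smul]; push_cast; abel
  rw [h3, h, h2, norm_neg]; ring

theorem one_le_norm_graphNormal {e : E} (he : ‖e‖ = 1) (φ : (ℝ ∙ e)ᗮ → ℝ) (y : (ℝ ∙ e)ᗮ) :
    1 ≤ ‖graphNormal e φ y‖ := by
  have h := norm_graphNormal_sq he φ y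
  have h2 : fderiv ℝ φ y (gradient φ y) = ‖gradient φ y‖ ^ 2 := by
    rw [← inner_gradient_left, real_inner_self_eq_norm_sq]
  nlinarith [sq_nonneg ‖gradient φ y‖, norm_nonneg (graphNormal e φ y)]

theorem normDet_graphDeriv {e : E} (he : ‖e‖ = 1) (φ : (ℝ ∙ e)ᗮ → ℝ) (y : (ℝ ∙ e)ᗮ) :
    (graphDeriv e (fderiv ℝ φ y) : (ℝ ∙ e)ᗮ →ₗ[ℝ] E).normDet = ‖graphNormal e φ y‖ := by
  set a := fderiv ℝ φ y with ha
  have h := (graphDeriv e a : (ℝ ∙ e)ᗮ →ₗ[ℝ] E).normDet_sq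
  have hadj : (LinearMap.adjoint (graphDeriv e a : (ℝ ∙ e)ᗮ →ₗ[ℝ] E)) ∘ₗ
      (graphDeriv e a : (ℝ ∙ e)ᗮ →ₗ[ℝ] E) =
      LinearMap.transvection (a : (ℝ ∙ e)ᗮ →ₗ[ℝ] ℝ) (gradient φ y) := by
    ext1 v
    refine ext_inner_right ℝ fun w => ?_
    have hw : ⟪gradient φ y, w⟫_ℝ = a w := inner_gradient_left
    have hv : ⟪(v : E), (w : E)⟫_ℝ = ⟪v, w⟫_ℝ := rfl
    rw [LinearMap.comp_apply, LinearMap.adjoint_inner_left, LinearMap.transvection.apply,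
      inner_add_left, inner_smul_left, hw]
    simp only [ContinuousLinearMap.coe_coe, graphDeriv_apply, inner_add_left, inner_add_right,
      inner_smul_left, inner_smul_right, inner_coe_orthogonal_singleton, hv,
      real_inner_self_eq_norm_sq, he, real_inner_comm e (v : E), RCLike.conj_to_real]
    ring
  rw [hadj, LinearMap.transvection.det] at h
  have h2 := norm_graphNormal_sq he φ y
  refine (sq_eq_sq₀ (LinearMap.normDet_nonneg _) (norm_nonneg _)).1 ?_
  rw [h2]
  exact h

variable [MeasurableSpace E] [BorelSpace E]

theorem measurableEmbedding_graphMap {e : E} {φ : (ℝ ∙ e)ᗮ → ℝ}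
    (hφ : Continuous φ) : MeasurableEmbedding (graphMap e φ) := by
  refine (continuous_graphMap hφ).measurableEmbedding fun y z h => ?_
  have := congrArg (ℝ ∙ e)ᗮ.orthogonalProjectionOnto h
  simpa only [graphMap, orthogonalProjectionOnto_coe_add_smul] using this

theorem measurable_graphNormal (e : E) (φ : (ℝ ∙ e)ᗮ → ℝ) : Measurable (graphNormal e φ) := by
  have h : Measurable (gradient φ) :=
    (InnerProductSpace.toDual ℝ (ℝ ∙ e)ᗮ).symm.continuous.measurable.comp (measurable_fderiv ℝ φ)
  exact measurable_const.sub (measurable_subtype_coe.comp h)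

/-- The surface measure of a Lipschitz graph is `√(1 + |∇φ|²) dy` in the graph parametrisation. -/
theorem restrict_range_graphMap {e : E} (he : ‖e‖ = 1) {φ : (ℝ ∙ e)ᗮ → ℝ} {L : ℝ≥0}
    (hφ : LipschitzWith L φ) :
    (μHE[finrank ℝ E - 1] : Measure E).restrict (Set.range (graphMap e φ)) =
      (volume.withDensity fun y => ENNReal.ofReal ‖graphNormal e φ y‖).map (graphMap e φ) := by
  have hemb := measurableEmbedding_graphMap (e := e) hφ.continuous
  rw [← hemb.map_comap, ← finrank_orthogonal_singleton_eq he,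
    comap_euclideanHausdorffMeasure_eq_withDensity (lipschitzWith_graphMap he hφ) hemb ?_]
  · congr 1
    refine withDensity_congr_ae ?_
    filter_upwards [hφ.ae_differentiableAt] with y hy
    rw [hy.hasFDerivAt.graphMap.fderiv, normDet_graphDeriv he]
  · intro y hy v
    rw [differentiableAt_graphMap_iff he] at hy
    rw [hy.hasFDerivAt.graphMap.fderiv, graphDeriv_apply]
    refine (sq_le_sq₀ (norm_nonneg _) (norm_nonneg _)).1 ?_
    rw [norm_coe_add_smul_sq he]
    nlinarith [sq_nonneg (fderiv ℝ φ y v)]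

theorem integrableOn_range_graphMap_iff {e : E} (he : ‖e‖ = 1) {φ : (ℝ ∙ e)ᗮ → ℝ} {L : ℝ≥0}
    (hφ : LipschitzWith L φ) (g : E → ℝ) :
    IntegrableOn g (Set.range (graphMap e φ)) μHE[finrank ℝ E - 1] ↔
      Integrable fun y => ‖graphNormal e φ y‖ * g (graphMap e φ y) := by
  have hemb := measurableEmbedding_graphMap (e := e) hφ.continuous
  rw [IntegrableOn, restrict_range_graphMap he hφ, hemb.integrable_map_iff,
    integrable_withDensity_iff_integrable_smul'
      (measurable_graphNormal e φ).norm.ennreal_ofReal (by simp)]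
  simp

theorem setIntegral_range_graphMap {e : E} (he : ‖e‖ = 1) {φ : (ℝ ∙ e)ᗮ → ℝ} {L : ℝ≥0}
    (hφ : LipschitzWith L φ) (g : E → ℝ) :
    ∫ x in Set.range (graphMap e φ), g x ∂μHE[finrank ℝ E - 1] =
      ∫ y, ‖graphNormal e φ y‖ * g (graphMap e φ y) := by
  have hemb := measurableEmbedding_graphMap (e := e) hφ.continuous
  rw [restrict_range_graphMap he hφ, hemb.integral_map,
    integral_withDensity_eq_integral_toReal_smul
      (measurable_graphNormal e φ).norm.ennreal_ofReal (by simp)]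
  simp

/-- The shear `(y, s) ↦ y + (φ(y) + s) e`, which straightens the graph of `φ`, preserves volume. -/
theorem measurePreserving_graphMap_add_smul {e : E} (he : ‖e‖ = 1) {φ : (ℝ ∙ e)ᗮ → ℝ}
    (hφ : Continuous φ) :
    MeasurePreserving (fun p : (ℝ ∙ e)ᗮ × ℝ => graphMap e φ p.1 + p.2 • e) := by
  have h1 : MeasurePreserving (fun p : (ℝ ∙ e)ᗮ × ℝ => (id p.1, φ p.1 + p.2))
      (volume.prod volume) (volume.prod volume) :=
    MeasurePreserving.skew_product (.id _)
      ((hφ.comp continuous_fst).add continuous_snd).measurable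
      (ae_of_all _ fun y => map_add_left_eq_self volume (φ y))
  have h2 : MeasurePreserving (Prod.map (id : (ℝ ∙ e)ᗮ → (ℝ ∙ e)ᗮ)
      (LinearIsometryEquiv.toSpanUnitSingleton (𝕜 := ℝ) e he))
      (volume.prod volume) (volume.prod volume) :=
    (MeasurePreserving.id _).prod (LinearIsometryEquiv.measurePreserving _)
  have h3 : MeasurePreserving (Prod.swap : (ℝ ∙ e)ᗮ × (ℝ ∙ e) → (ℝ ∙ e) × (ℝ ∙ e)ᗮ)
      (volume.prod volume) (volume.prod volume) := Measure.measurePreserving_swap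
  have h4 := ((ℝ ∙ e).measurePreserving_measurableEquivProd (0 : E)).symm
  rw [InnerProductSpace.euclideanHausdorffMeasure_eq_volume] at h4
  have := h4.comp (h3.comp (h2.comp h1))
  convert! this using 1
  ext p
  simp only [Function.comp, Prod.map, Prod.swap, Submodule.measurableEquivProd_symm_apply,
    LinearIsometryEquiv.toSpanUnitSingleton_apply, id, vadd_eq_add, add_zero, graphMap, add_smul]
  abel

theorem measurableEmbedding_graphMap_add_smul {e : E} (he : ‖e‖ = 1) {φ : (ℝ ∙ e)ᗮ → ℝ}
    (hφ : Continuous φ) :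
    MeasurableEmbedding (fun p : (ℝ ∙ e)ᗮ × ℝ => graphMap e φ p.1 + p.2 • e) := by
  refine Continuous.measurableEmbedding (((continuous_graphMap hφ).comp continuous_fst).add
    (continuous_snd.smul continuous_const)) fun p q h => ?_
  simp only [graphMap, add_assoc, ← add_smul] at h
  have h1 := congrArg (ℝ ∙ e)ᗮ.orthogonalProjectionOnto h
  have h2 := congrArg (fun x => ⟪e, x⟫_ℝ) h
  simp only [orthogonalProjectionOnto_coe_add_smul, inner_add_smul_self he] at h1 h2
  rw [h1] at h2
  exact Prod.ext h1 (add_left_cancel h2)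

end Graph

/-! ### The divergence theorem below a Lipschitz graph -/

section Hypograph

open Module

theorem integral_lineDeriv_eq_zero {V : Type*} [NormedAddCommGroup V] [NormedSpace ℝ V]
    [FiniteDimensional ℝ V] [MeasurableSpace V] [BorelSpace V] {μ : Measure V}
    [μ.IsAddHaarMeasure] {g : V → ℝ} {C : ℝ≥0} (hg : LipschitzWith C g) (hc : HasCompactSupport g)
    (v : V) : ∫ x, lineDeriv ℝ g x v ∂μ = 0 := by
  have := LipschitzWith.integral_lineDeriv_mul_eq (μ := μ) (LipschitzWith.const (1 : ℝ)) hg hc (-v)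
  have h0 : ∀ x, lineDeriv ℝ (fun _ : V => (1 : ℝ)) x (-v) = 0 := fun x => by simp [lineDeriv]
  simpa [h0] using this.symm

variable {E : Type*} [NormedAddCommGroup E] [InnerProductSpace ℝ E]

theorem preimage_hypograph {e : E} (he : ‖e‖ = 1) (φ : (ℝ ∙ e)ᗮ → ℝ) :
    (fun p : (ℝ ∙ e)ᗮ × ℝ => graphMap e φ p.1 + p.2 • e) ⁻¹' hypograph e φ =
      Set.univ ×ˢ Set.Iio 0 := by
  ext p
  simp only [hypograph, Set.mem_preimage, Set.mem_ofPred_eq, graphMap, add_assoc, ← add_smul,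
    inner_add_smul_self he, orthogonalProjectionOnto_coe_add_smul]
  simp

theorem hasCompactSupport_comp_graphMap_add_smul {e : E} (he : ‖e‖ = 1) {φ : (ℝ ∙ e)ᗮ → ℝ}
    (hφ : Continuous φ) {g : E → ℝ} (hg : HasCompactSupport g) :
    HasCompactSupport (fun p : (ℝ ∙ e)ᗮ × ℝ => g (graphMap e φ p.1 + p.2 • e)) := by
  let π := fun x : E => (ℝ ∙ e)ᗮ.orthogonalProjectionOnto x
  let T : E → (ℝ ∙ e)ᗮ × ℝ := fun x => (π x, ⟪e, x⟫_ℝ - φ (π x))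
  have hπ : Continuous π := (ℝ ∙ e)ᗮ.orthogonalProjectionOnto.continuous
  have hT : Continuous T := by fun_prop
  refine HasCompactSupport.intro (hg.isCompact.image hT) fun p hp => ?_
  refine image_eq_zero_of_notMem_tsupport fun hmem => hp ⟨_, hmem, ?_⟩
  simp only [T, π, graphMap, add_assoc, ← add_smul, inner_add_smul_self he,
    orthogonalProjectionOnto_coe_add_smul, add_sub_cancel_left]

theorem integral_Iio_fderiv_add_smul {f : E → ℝ} (hf : ContDiff ℝ 1 f)
    (hc : HasCompactSupport f) {e : E} (he : e ≠ 0) (x : E) :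
    ∫ s in Set.Iio (0 : ℝ), fderiv ℝ f (x + s • e) e = f x := by
  have hd : ∀ s : ℝ, HasDerivAt (fun s : ℝ => f (x + s • e)) (fderiv ℝ f (x + s • e) e) s := by
    intro s
    have h1 : HasDerivAt (fun s : ℝ => x + s • e) e s := by
      simpa using ((hasDerivAt_id s).smul_const e).const_add x
    exact ((hf.differentiable one_ne_zero _).hasFDerivAt).comp_hasDerivAt s h1
  have hcs : HasCompactSupport (fun s : ℝ => f (x + s • e)) :=
    hc.comp_isClosedEmbedding ((Homeomorph.addLeft x).isClosedEmbedding.comp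
      (isClosedEmbedding_smul_left he))
  have hcd : ContDiff ℝ 1 (fun s : ℝ => f (x + s • e)) := by fun_prop
  have := hcs.integral_Iic_deriv_eq hcd 0
  rw [← integral_Iic_eq_integral_Iio]
  simpa [(hd _).deriv] using this

variable [FiniteDimensional ℝ E] [MeasurableSpace E] [BorelSpace E]

/-- Integrating a directional derivative over the region below a Lipschitz graph. The direction `e`
is handled by the fundamental theorem of calculus on vertical lines. For a direction `b` tangent
to the hyperplane, the `b`-derivative of `y ↦ f (y + (φ y + s) e)` integrates to zero over each
translate of the graph, which trades `∂_b f` for `-∂_b φ ∂_e f`. -/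
theorem setIntegral_hypograph_fderiv {e : E} (he : ‖e‖ = 1) {φ : (ℝ ∙ e)ᗮ → ℝ} {L : ℝ≥0}
    (hφ : LipschitzWith L φ) {f : E → ℝ} (hf : ContDiff ℝ 1 f) (hc : HasCompactSupport f) (v : E) :
    ∫ x in hypograph e φ, fderiv ℝ f x v =
      ∫ y, f (graphMap e φ y) * ⟪v, graphNormal e φ y⟫_ℝ := by
  have he0 : e ≠ 0 := fun h => by simp [h] at he
  set b := (ℝ ∙ e)ᗮ.orthogonalProjectionOnto v with hb
  set t := ⟪e, v⟫_ℝ with ht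
  have hv : (b : E) + t • e = v := orthogonalProjectionOnto_add_inner_smul he v
  set Ψ := fun p : (ℝ ∙ e)ᗮ × ℝ => graphMap e φ p.1 + p.2 • e with hΨ
  have hΨc : Continuous Ψ := ((continuous_graphMap hφ.continuous).comp continuous_fst).add
    (continuous_snd.smul continuous_const)
  have hcont : ∀ w : E, Continuous fun x => fderiv ℝ f x w := fun w =>
    (hf.continuous_fderiv one_ne_zero).clm_apply continuous_const
  have hint : ∀ w : E, Integrable (fun p => fderiv ℝ f (Ψ p) w) := fun w => by
    refine Continuous.integrable_of_hasCompactSupport ((hcont w).comp hΨc) ?_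
    exact hasCompactSupport_comp_graphMap_add_smul he hφ.continuous
      (g := fun x => fderiv ℝ f x w) (hc.fderiv_apply ℝ w)
  have hbd : ∀ y, ‖fderiv ℝ φ y b‖ ≤ L * ‖b‖ := fun y =>
    (fderiv ℝ φ y).le_of_opNorm_le (norm_fderiv_le_of_lipschitz ℝ hφ) b
  have hint2 : Integrable (fun p : (ℝ ∙ e)ᗮ × ℝ => fderiv ℝ φ p.1 b * fderiv ℝ f (Ψ p) e) := by
    refine (hint e).bdd_mul (c := L * ‖b‖) ?_ (ae_of_all _ fun p => hbd p.1)
    exact ((measurable_fderiv_apply_const ℝ φ b).comp measurable_fst).aestronglyMeasurable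
  have hrest : ∀ g : (ℝ ∙ e)ᗮ × ℝ → ℝ, Integrable g →
      Integrable g ((volume : Measure (ℝ ∙ e)ᗮ).prod (volume.restrict (Set.Iio (0 : ℝ)))) := by
    intro g hg
    have := hg.restrict (s := Set.univ ×ˢ Set.Iio (0 : ℝ))
    rwa [Measure.volume_eq_prod, ← Measure.prod_restrict, Measure.restrict_univ] at this
  -- Straighten the graph.
  have e1 : ∫ x in hypograph e φ, fderiv ℝ f x v =
      ∫ p, fderiv ℝ f (Ψ p) v
        ∂((volume : Measure (ℝ ∙ e)ᗮ).prod (volume.restrict (Set.Iio (0 : ℝ)))) := by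
    rw [← (measurePreserving_graphMap_add_smul he hφ.continuous).setIntegral_preimage_emb
      (measurableEmbedding_graphMap_add_smul he hφ.continuous), preimage_hypograph he,
      Measure.volume_eq_prod, ← Measure.prod_restrict, Measure.restrict_univ]
  -- On each translate of the graph, trade the tangential derivative for the vertical one.
  have e2 : ∀ s : ℝ, ∫ y, fderiv ℝ f (Ψ (y, s)) b =
      -∫ y, fderiv ℝ φ y b * fderiv ℝ f (Ψ (y, s)) e := by
    intro s
    obtain ⟨C, hC⟩ := hf.lipschitzWith_of_hasCompactSupport hc one_ne_zero
    have hgl : LipschitzWith (C * ((1 + L) + 0)) fun y => f (Ψ (y, s)) :=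
      hC.comp ((lipschitzWith_graphMap he hφ).add (LipschitzWith.const' (s • e)))
    have hgc : HasCompactSupport fun y => f (Ψ (y, s)) := by
      refine HasCompactSupport.intro (hc.isCompact.image
        (ℝ ∙ e)ᗮ.orthogonalProjectionOnto.continuous) fun y hy => ?_
      refine image_eq_zero_of_notMem_tsupport fun hmem => hy ⟨_, hmem, ?_⟩
      simp only [Ψ, graphMap, add_assoc, ← add_smul, orthogonalProjectionOnto_coe_add_smul]
    have h0 := integral_lineDeriv_eq_zero (μ := volume) hgl hgc b
    have hs : ∀ w : E, Integrable fun y : (ℝ ∙ e)ᗮ => fderiv ℝ f (Ψ (y, s)) w := fun w => by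
      refine Continuous.integrable_of_hasCompactSupport
        ((hcont w).comp (hΨc.comp (by fun_prop))) ?_
      refine HasCompactSupport.intro (hc.isCompact.image
        (ℝ ∙ e)ᗮ.orthogonalProjectionOnto.continuous) fun y hy => ?_
      refine image_eq_zero_of_notMem_tsupport (f := fun x => fderiv ℝ f x w) fun hmem =>
        hy ⟨_, tsupport_fderiv_apply_subset ℝ w hmem, ?_⟩
      simp only [Ψ, graphMap, add_assoc, ← add_smul, orthogonalProjectionOnto_coe_add_smul]
    have hs2 : Integrable fun y : (ℝ ∙ e)ᗮ => fderiv ℝ φ y b * fderiv ℝ f (Ψ (y, s)) e :=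
      (hs e).bdd_mul (c := L * ‖b‖)
        (measurable_fderiv_apply_const ℝ φ b).aestronglyMeasurable (ae_of_all _ hbd)
    have h1 : ∀ᵐ y : (ℝ ∙ e)ᗮ, lineDeriv ℝ (fun y => f (Ψ (y, s))) y b =
        fderiv ℝ f (Ψ (y, s)) b + fderiv ℝ φ y b * fderiv ℝ f (Ψ (y, s)) e := by
      filter_upwards [hφ.ae_differentiableAt] with y hy
      have h2 : HasFDerivAt (fun y => Ψ (y, s)) (graphDeriv e (fderiv ℝ φ y)) y :=
        hy.hasFDerivAt.graphMap.add_const (s • e)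
      have h3 : HasFDerivAt (fun y => f (Ψ (y, s))) _ y :=
        ((hf.differentiable one_ne_zero (Ψ (y, s))).hasFDerivAt).comp y h2
      rw [(h3.hasLineDerivAt b).lineDeriv, ContinuousLinearMap.comp_apply, graphDeriv_apply,
        map_add, map_smul, smul_eq_mul]
    rw [integral_congr_ae h1, integral_add (hs b) hs2] at h0
    linarith
  -- Recombine by Fubini and the fundamental theorem of calculus on vertical lines.
  have e3 : ∫ p, fderiv ℝ f (Ψ p) b
        ∂((volume : Measure (ℝ ∙ e)ᗮ).prod (volume.restrict (Set.Iio (0 : ℝ)))) =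
      -∫ p, fderiv ℝ φ p.1 b * fderiv ℝ f (Ψ p) e
        ∂((volume : Measure (ℝ ∙ e)ᗮ).prod (volume.restrict (Set.Iio (0 : ℝ)))) := by
    rw [integral_prod_symm _ (hrest _ (hint b)), integral_prod_symm _ (hrest _ hint2),
      ← integral_neg]
    exact integral_congr_ae (ae_of_all _ fun s => e2 s)
  have e4 : ∀ y, ∫ s in Set.Iio (0 : ℝ), fderiv ℝ f (Ψ (y, s)) e = f (graphMap e φ y) := fun y =>
    integral_Iio_fderiv_add_smul hf hc he0 (graphMap e φ y)
  calc ∫ x in hypograph e φ, fderiv ℝ f x v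
      = ∫ p, (t * fderiv ℝ f (Ψ p) e - fderiv ℝ φ p.1 b * fderiv ℝ f (Ψ p) e)
          ∂((volume : Measure (ℝ ∙ e)ᗮ).prod (volume.restrict (Set.Iio (0 : ℝ)))) := by
        rw [e1, integral_sub ((hrest _ (hint e)).const_mul t) (hrest _ hint2), sub_eq_add_neg,
          ← e3, add_comm, ← integral_add (hrest _ (hint b)) ((hrest _ (hint e)).const_mul t)]
        simp_rw [← smul_eq_mul, ← map_smul, ← map_add, hv]
    _ = ∫ y, (t - fderiv ℝ φ y b) * f (graphMap e φ y) := by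
        rw [integral_prod (fun p => t * fderiv ℝ f (Ψ p) e - fderiv ℝ φ p.1 b * fderiv ℝ f (Ψ p) e)
          (((hrest _ (hint e)).const_mul t).sub (hrest _ hint2))]
        simp_rw [← sub_mul, integral_const_mul, e4]
    _ = _ := by
        refine integral_congr_ae (ae_of_all _ fun y => ?_)
        simp only
        rw [← hv, real_inner_comm, inner_graphNormal_coe_add_smul he, mul_comm]

end Hypograph

/-! ### The outward normal -/

theorem IsOutwardUnitNormal.unique {d : ℕ} {Ω : Set (Space d)} {x ν ν' : Space d}
    (h : IsOutwardUnitNormal Ω x ν) (h' : IsOutwardUnitNormal Ω x ν') : ν = ν' := by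
  by_contra hne
  -- A short step in the direction `ν' - ν` would lead both into and out of `Ω`.
  set w := ν' - ν with hw
  have hw0 : 0 < ‖w‖ := norm_pos_iff.2 (sub_ne_zero.2 (Ne.symm hne))
  have hn : ‖w‖ ^ 2 = 2 * (1 - ⟪ν, ν'⟫_ℝ) := by
    rw [hw, norm_sub_sq_real, h.1, h'.1, real_inner_comm]; ring
  have h1 : ⟪ν, w⟫_ℝ = -(‖w‖ ^ 2 / 2) := by
    rw [hn, hw, inner_sub_right, real_inner_self_eq_norm_sq, h.1]; ring
  have h2 : ⟪ν', w⟫_ℝ = ‖w‖ ^ 2 / 2 := by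
    rw [hn, hw, inner_sub_right, real_inner_self_eq_norm_sq, h'.1, real_inner_comm]; ring
  have hlim : Tendsto (fun t : ℝ => x + t • w) (𝓝[>] 0) (𝓝 x) := by
    have : ContinuousAt (fun t : ℝ => x + t • w) 0 := by fun_prop
    simpa using this.tendsto.mono_left (nhdsWithin_le_nhds (s := Set.Ioi 0))
  have hε : 0 < ‖w‖ / 4 := by positivity
  obtain ⟨t, ⟨ht1, ht2⟩, ht⟩ := ((hlim.eventually ((h.2 _ hε).and (h'.2 _ hε))).and
    self_mem_nhdsWithin).exists
  have ht : 0 < t := ht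
  have hpos : 0 < t * ‖w‖ ^ 2 := by positivity
  simp only [add_sub_cancel_left, inner_smul_right, h1, h2, norm_smul, Real.norm_eq_abs,
    abs_of_pos ht] at ht1 ht2
  exact ht2.2 (by nlinarith) (ht1.1 (by nlinarith))

theorem IsOutwardUnitNormal.outwardNormal_eq {d : ℕ} {Ω : Set (Space d)} {x ν : Space d}
    (h : IsOutwardUnitNormal Ω x ν) : outwardNormal Ω x = ν := by
  have hex : ∃ ν, IsOutwardUnitNormal Ω x ν := ⟨ν, h⟩
  rw [outwardNormal, dif_pos hex]
  exact hex.choose_spec.unique h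

theorem isOutwardUnitNormal_graphNormal {d : ℕ} {Ω : Set (Space d)} {e : Space d} (he : ‖e‖ = 1)
    {φ : (ℝ ∙ e)ᗮ → ℝ} {y : (ℝ ∙ e)ᗮ} (hy : DifferentiableAt ℝ φ y)
    (hΩ : ∀ᶠ x in 𝓝 (graphMap e φ y), x ∈ Ω ↔ x ∈ hypograph e φ) :
    IsOutwardUnitNormal Ω (graphMap e φ y) (‖graphNormal e φ y‖⁻¹ • graphNormal e φ y) := by
  have hN := one_le_norm_graphNormal he φ y
  have hN0 : 0 < ‖graphNormal e φ y‖ := by linarith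
  refine ⟨by rw [norm_smul, norm_inv, norm_norm, inv_mul_cancel₀ hN0.ne'], fun ε hε => ?_⟩
  have hlim : Tendsto (fun x => (ℝ ∙ e)ᗮ.orthogonalProjectionOnto x) (𝓝 (graphMap e φ y))
      (𝓝 y) := by
    have := (ℝ ∙ e)ᗮ.orthogonalProjectionOnto.continuous.tendsto (graphMap e φ y)
    rwa [graphMap, orthogonalProjectionOnto_coe_add_smul] at this
  filter_upwards [hΩ, hlim.eventually (hy.hasFDerivAt.isLittleO.def hε)] with x hx hx2
  rw [hx, hypograph, Set.mem_ofPred_eq]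
  set z := (ℝ ∙ e)ᗮ.orthogonalProjectionOnto x with hz
  have hxz : x - graphMap e φ y = ((z - y : (ℝ ∙ e)ᗮ) : Space d) + (⟪e, x⟫_ℝ - φ y) • e := by
    conv_lhs => rw [← orthogonalProjectionOnto_add_inner_smul he x, graphMap]
    rw [sub_smul]; push_cast; abel
  have hle : ‖z - y‖ ≤ ‖x - graphMap e φ y‖ := by
    refine (sq_le_sq₀ (norm_nonneg _) (norm_nonneg _)).1 ?_
    rw [hxz, norm_coe_add_smul_sq he]
    exact le_add_of_nonneg_right (sq_nonneg _)
  have hinner : ⟪graphNormal e φ y, x - graphMap e φ y⟫_ℝ =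
      ⟪e, x⟫_ℝ - φ y - fderiv ℝ φ y (z - y) := by
    rw [hxz, inner_graphNormal_coe_add_smul he]
  rw [Real.norm_eq_abs, abs_le] at hx2
  have hb : ε * ‖z - y‖ ≤ ε * ‖x - graphMap e φ y‖ := by gcongr
  have hc : ε * ‖x - graphMap e φ y‖ ≤ ‖graphNormal e φ y‖ * (ε * ‖x - graphMap e φ y‖) :=
    le_mul_of_one_le_left (by positivity) hN
  rw [inner_smul_left, RCLike.conj_to_real, hinner, inv_mul_eq_div]
  constructor
  · intro h
    rw [div_lt_iff₀ hN0] at h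
    nlinarith
  · intro h
    rw [lt_div_iff₀ hN0] at h
    nlinarith

/-! ### The divergence theorem on a Lipschitz domain -/

theorem frontier_hypograph {E : Type*} [NormedAddCommGroup E] [InnerProductSpace ℝ E]
    {e : E} (he : ‖e‖ = 1) {φ : (ℝ ∙ e)ᗮ → ℝ} (hφ : Continuous φ) :
    frontier (hypograph e φ) = Set.range (graphMap e φ) := by
  have hc1 : Continuous fun x : E => ⟪e, x⟫_ℝ := by fun_prop
  have hc2 : Continuous fun x : E => φ ((ℝ ∙ e)ᗮ.orthogonalProjectionOnto x) :=
    hφ.comp (ℝ ∙ e)ᗮ.orthogonalProjectionOnto.continuous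
  refine Set.Subset.antisymm ?_ ?_
  · rw [range_graphMap he]
    exact frontier_lt_subset_eq hc1 hc2
  · rintro _ ⟨y, rfl⟩
    have hmem : ∀ t : ℝ, graphMap e φ y + t • e ∈ hypograph e φ ↔ t < 0 := fun t => by
      simp only [hypograph, Set.mem_ofPred_eq, graphMap, add_assoc, ← add_smul,
        inner_add_smul_self he, orthogonalProjectionOnto_coe_add_smul]
      simp
    rw [(show IsOpen (hypograph e φ) from isOpen_lt hc1 hc2).frontier_eq]
    refine ⟨?_, fun h => lt_irrefl (0 : ℝ) ((hmem 0).1 (by simpa using h))⟩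
    have hlim : Tendsto (fun t : ℝ => graphMap e φ y + t • e) (𝓝[<] 0) (𝓝 (graphMap e φ y)) := by
      have : ContinuousAt (fun t : ℝ => graphMap e φ y + t • e) 0 := by fun_prop
      simpa using this.tendsto.mono_left (nhdsWithin_le_nhds (s := Set.Iio 0))
    exact mem_closure_of_tendsto hlim (eventually_mem_nhdsWithin.mono fun t ht => (hmem t).2 ht)

/-- The divergence theorem for the field `f • v`, with `v` a constant vector. -/
def GaussGreen {d : ℕ} (Ω : Set (Space d)) (f : Space d → ℝ) : Prop :=
  ∀ v : Space d, Integrable (fun x => f x * ⟪v, outwardNormal Ω x⟫_ℝ) (surfaceMeasure Ω) ∧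
    ∫ x in Ω, fderiv ℝ f x v = ∫ x, f x * ⟪v, outwardNormal Ω x⟫_ℝ ∂(surfaceMeasure Ω)

theorem integrable_fderiv_apply {E : Type*} [NormedAddCommGroup E] [NormedSpace ℝ E]
    [FiniteDimensional ℝ E] [MeasurableSpace E] [BorelSpace E] {μ : Measure E}
    [IsFiniteMeasureOnCompacts μ] {f : E → ℝ} (hf : ContDiff ℝ 1 f) (hc : HasCompactSupport f)
    (v : E) : Integrable (fun x => fderiv ℝ f x v) μ :=
  ((hf.continuous_fderiv one_ne_zero).clm_apply continuous_const).integrable_of_hasCompactSupport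
    (hc.fderiv_apply ℝ v)

theorem gaussGreen_of_disjoint_frontier {d : ℕ} {Ω : Set (Space d)} {f : Space d → ℝ}
    (hf : ContDiff ℝ 1 f) (hc : HasCompactSupport f)
    (hsupp : tsupport f ⊆ Ω ∨ Disjoint (tsupport f) Ω) (hfr : Disjoint (tsupport f) (frontier Ω)) :
    GaussGreen Ω f := by
  intro v
  have hz : ∀ᵐ x ∂(surfaceMeasure Ω), f x * ⟪v, outwardNormal Ω x⟫_ℝ = 0 := by
    filter_upwards [ae_restrict_mem isClosed_frontier.measurableSet] with x hx
    rw [image_eq_zero_of_notMem_tsupport (hfr.notMem_of_mem_right hx), zero_mul]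
  refine ⟨(integrable_zero _ _ _).congr (hz.mono fun x hx => hx.symm), ?_⟩
  rw [integral_eq_zero_of_ae hz]
  have hsub : tsupport (fun x => fderiv ℝ f x v) ⊆ tsupport f := tsupport_fderiv_apply_subset ℝ v
  rcases hsupp with h | h
  · rw [setIntegral_eq_integral_of_forall_compl_eq_zero fun x hx =>
      image_eq_zero_of_notMem_tsupport (f := fun x => fderiv ℝ f x v) fun hx' => hx (h (hsub hx'))]
    obtain ⟨C, hC⟩ := hf.lipschitzWith_of_hasCompactSupport hc one_ne_zero
    rw [← integral_lineDeriv_eq_zero (μ := volume) hC hc v]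
    simp_rw [((hf.differentiable one_ne_zero) _).lineDeriv_eq_fderiv]
  · exact setIntegral_eq_zero_of_forall_eq_zero fun x hx =>
      image_eq_zero_of_notMem_tsupport (f := fun x => fderiv ℝ f x v)
        fun hx' => h.notMem_of_mem_right hx (hsub hx')

/-- The divergence theorem for `f` supported where `Ω` is the region below a Lipschitz graph. -/
theorem gaussGreen_of_tsupport_subset_chart {d : ℕ} {Ω B : Set (Space d)} (hB : IsOpen B)
    {e : Space d} (he : ‖e‖ = 1) {φ : (ℝ ∙ e)ᗮ → ℝ} {L : ℝ≥0} (hφ : LipschitzWith L φ)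
    (hΩ : ∀ x ∈ B, x ∈ Ω ↔ x ∈ hypograph e φ) {f : Space d → ℝ} (hf : ContDiff ℝ 1 f)
    (hc : HasCompactSupport f) (hsupp : tsupport f ⊆ B) : GaussGreen Ω f := by
  intro v
  have hΩB : Ω ∩ B = hypograph e φ ∩ B := Set.ext fun x =>
    and_congr_left fun hx => hΩ x hx
  have hfr : frontier Ω ∩ B = Set.range (graphMap e φ) ∩ B := by
    rw [← frontier_hypograph he hφ.continuous, ← frontier_inter_open_inter hB, hΩB,
      frontier_inter_open_inter hB]
  have hf0 : ∀ x, x ∉ B → f x = 0 := fun x hx =>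
    image_eq_zero_of_notMem_tsupport fun h => hx (hsupp h)
  have hoff' : ∀ x, x ∉ B → fderiv ℝ f x v = 0 := fun x hx =>
    image_eq_zero_of_notMem_tsupport (f := fun x => fderiv ℝ f x v)
      fun h => hx (hsupp (tsupport_fderiv_apply_subset ℝ v h))
  set g : Space d → ℝ := fun x => f x * ⟪v, outwardNormal Ω x⟫_ℝ with hg
  have hg0 : ∀ x, x ∉ B → g x = 0 := fun x hx => by rw [hg]; simp only; rw [hf0 x hx, zero_mul]
  have hgB : Function.support g ⊆ B := fun x hx => by_contra fun h => hx (hg0 x h)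
  set m : Measure (Space d) := μHE[d - 1] with hm
  have hm' : m = μHE[Module.finrank ℝ (Space d) - 1] := by rw [finrank_euclideanSpace_fin]
  have hmeas : (surfaceMeasure Ω).restrict B =
      (m.restrict (Set.range (graphMap e φ))).restrict B := by
    rw [surfaceMeasure, Measure.restrict_restrict hB.measurableSet,
      Measure.restrict_restrict hB.measurableSet, Set.inter_comm, hfr, Set.inter_comm]
  -- The normalisation of the normal cancels against the surface density.
  have hae : ∀ᵐ y : (ℝ ∙ e)ᗮ, ‖graphNormal e φ y‖ * g (graphMap e φ y) =
      f (graphMap e φ y) * ⟪v, graphNormal e φ y⟫_ℝ := by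
    filter_upwards [hφ.ae_differentiableAt] with y hy
    by_cases hyB : graphMap e φ y ∈ B
    · have hN := one_le_norm_graphNormal he φ y
      have hnorm := isOutwardUnitNormal_graphNormal he hy (Ω := Ω)
        (by filter_upwards [hB.mem_nhds hyB] with x hx using hΩ x hx)
      simp only [hg]
      rw [hnorm.outwardNormal_eq, inner_smul_right]
      field_simp
    · rw [hg0 _ hyB, hf0 _ hyB, mul_zero, zero_mul]
  have hgi : Integrable (fun y => f (graphMap e φ y) * ⟪v, graphNormal e φ y⟫_ℝ) := by
    have hcf : HasCompactSupport fun y => f (graphMap e φ y) := by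
      refine HasCompactSupport.intro (hc.isCompact.image
        (ℝ ∙ e)ᗮ.orthogonalProjectionOnto.continuous) fun y hy => ?_
      refine image_eq_zero_of_notMem_tsupport fun hmem => hy ⟨_, hmem, ?_⟩
      rw [graphMap, orthogonalProjectionOnto_coe_add_smul]
    have hfi : Integrable fun y => f (graphMap e φ y) :=
      (hf.continuous.comp (continuous_graphMap hφ.continuous)).integrable_of_hasCompactSupport hcf
    refine hfi.mul_bdd (c := ‖v‖ * (1 + L)) ?_ (ae_of_all _ fun y => ?_)
    · exact (measurable_const.inner (measurable_graphNormal e φ)).aestronglyMeasurable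
    · refine (norm_inner_le_norm _ _).trans ?_
      gcongr
      refine (norm_sub_le _ _).trans (add_le_add he.le ?_)
      have : ‖gradient φ y‖ = ‖fderiv ℝ φ y‖ := by simp [gradient]
      exact this.le.trans (norm_fderiv_le_of_lipschitz ℝ hφ)
  constructor
  · rw [← integrableOn_iff_integrable_of_support_subset (s := B) hgB, IntegrableOn, hmeas,
      ← IntegrableOn,
      integrableOn_iff_integrable_of_support_subset hgB, hm', ← IntegrableOn,
      integrableOn_range_graphMap_iff he hφ]
    exact hgi.congr (hae.mono fun y hy => hy.symm)
  · have h1 : ∫ x in Ω, fderiv ℝ f x v = ∫ x in hypograph e φ, fderiv ℝ f x v := by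
      rw [← setIntegral_eq_integral_of_forall_compl_eq_zero (s := B) hoff',
        ← setIntegral_eq_integral_of_forall_compl_eq_zero (s := B)
          (μ := volume.restrict (hypograph e φ)) hoff',
        Measure.restrict_restrict hB.measurableSet, Measure.restrict_restrict hB.measurableSet,
        Set.inter_comm, hΩB, Set.inter_comm]
    rw [h1, setIntegral_hypograph_fderiv he hφ hf hc,
      ← setIntegral_eq_integral_of_forall_compl_eq_zero (s := B) (f := g) hg0, hmeas,
      setIntegral_eq_integral_of_forall_compl_eq_zero (s := B) (f := g) hg0, hm',
      setIntegral_range_graphMap he hφ]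
    exact integral_congr_ae (hae.mono fun y hy => hy.symm)

/-- The divergence theorem holds near every point, whether inside `Ω`, on `∂Ω` or outside. -/
theorem exists_isOpen_gaussGreen {d : ℕ} {Ω : Set (Space d)} (hΩ : IsOpen Ω)
    (hLip : HasLipschitzBoundary Ω) (x : Space d) :
    ∃ U : Set (Space d), IsOpen U ∧ x ∈ U ∧ ∀ f : Space d → ℝ, ContDiff ℝ 1 f →
      HasCompactSupport f → tsupport f ⊆ U → GaussGreen Ω f := by
  by_cases hx : x ∈ Ω
  · refine ⟨Ω, hΩ, hx, fun f hf hc hs => gaussGreen_of_disjoint_frontier hf hc (Or.inl hs) ?_⟩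
    rw [hΩ.frontier_eq]
    exact Set.disjoint_left.2 fun y hy h => h.2 (hs hy)
  by_cases hx2 : x ∈ closure Ω
  · obtain ⟨e, he, r, hr, L, φ, hφ, hy⟩ := hLip x (by rw [hΩ.frontier_eq]; exact ⟨hx2, hx⟩)
    exact ⟨Metric.ball x r, Metric.isOpen_ball, Metric.mem_ball_self hr, fun f hf hc hs =>
      gaussGreen_of_tsupport_subset_chart Metric.isOpen_ball he hφ hy hf hc hs⟩
  · refine ⟨(closure Ω)ᶜ, isClosed_closure.isOpen_compl, hx2, fun f hf hc hs =>
      gaussGreen_of_disjoint_frontier hf hc (Or.inr ?_) ?_⟩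
    · exact Set.disjoint_left.2 fun y hy h => hs hy (subset_closure h)
    · exact Set.disjoint_left.2 fun y hy h => hs hy (frontier_subset_closure h)

theorem GaussGreen.sum {d : ℕ} {Ω : Set (Space d)} {ι : Type*} (s : Finset ι)
    {f : ι → Space d → ℝ} (hf : ∀ i ∈ s, ContDiff ℝ 1 (f i))
    (hc : ∀ i ∈ s, HasCompactSupport (f i)) (h : ∀ i ∈ s, GaussGreen Ω (f i)) :
    GaussGreen Ω (fun x => ∑ i ∈ s, f i x) := by
  intro v
  simp_rw [Finset.sum_mul]
  refine ⟨integrable_finsetSum _ fun i hi => (h i hi v).1, ?_⟩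
  rw [integral_finsetSum _ fun i hi => (h i hi v).1,
    ← Finset.sum_congr rfl fun i hi => (h i hi v).2,
    ← integral_finsetSum _ fun i hi => integrable_fderiv_apply (hf i hi) (hc i hi) v]
  refine integral_congr_ae (ae_of_all _ fun x => ?_)
  simp only
  rw [fderiv_fun_sum fun i hi => (hf i hi).differentiable one_ne_zero x, sum_apply]

/-- The divergence theorem on a Lipschitz domain: a partition of unity reduces it to charts. -/
theorem gaussGreen_of_contDiff {d : ℕ} {Ω : Set (Space d)} (hΩ : IsOpen Ω)
    (hLip : HasLipschitzBoundary Ω) {f : Space d → ℝ} (hf : ContDiff ℝ 1 f)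
    (hc : HasCompactSupport f) : GaussGreen Ω f := by
  choose U hUo hxU hU using exists_isOpen_gaussGreen hΩ hLip
  obtain ⟨t, -, ht⟩ := hc.isCompact.elim_nhds_subcover U fun x _ => (hUo x).mem_nhds (hxU x)
  obtain ⟨ρ, hρ⟩ := SmoothPartitionOfUnity.exists_isSubordinate
    (modelWithCornersSelf ℝ (Space d)) (isClosed_tsupport f) (fun i : t => U i) (fun i => hUo i)
    (fun x hx => by simpa using ht hx)
  have hρs : ∀ i, ContDiff ℝ 1 (ρ i) := fun i =>
    ((ρ i).contMDiff.contDiff).of_le (by exact_mod_cast le_top)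
  have hfρ : f = fun x => ∑ i : t, ρ i x * f x := by
    ext x
    rw [← Finset.sum_mul]
    by_cases hx : x ∈ tsupport f
    · have := ρ.sum_eq_one hx
      rw [finsum_eq_sum_of_fintype] at this
      rw [this, one_mul]
    · rw [image_eq_zero_of_notMem_tsupport hx, mul_zero]
  rw [hfρ]
  refine GaussGreen.sum _ (fun i _ => (hρs i).mul hf) (fun i _ => hc.mul_left) fun i _ =>
    hU i _ ((hρs i).mul hf) hc.mul_left ?_
  exact (tsupport_mul_subset_left).trans (hρ i)

/-! ### Green's formula for smooth functions -/

theorem inner_eq_sum_mul_inner_single {d : ℕ} (x n : Space d) :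
    ⟪x, n⟫_ℝ = ∑ i, x i * ⟪(EuclideanSpace.single i 1 : Space d), n⟫_ℝ := by
  conv_lhs => rw [← (EuclideanSpace.basisFun (Fin d) ℝ).sum_repr x, sum_inner]
  simp [inner_smul_left]

theorem contDiff_coord {d : ℕ} {w : Space d → Space d} (hw : ContDiff ℝ 1 w) (i : Fin d) :
    ContDiff ℝ 1 fun x => w x i :=
  (EuclideanSpace.proj (𝕜 := ℝ) i).contDiff.comp hw

theorem hasCompactSupport_coord {d : ℕ} {w : Space d → Space d} (hw : HasCompactSupport w)
    (i : Fin d) : HasCompactSupport fun x => w x i :=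
  hw.comp_left (g := fun y : Space d => y i) rfl

theorem fderiv_coord {d : ℕ} {w : Space d → Space d} (hw : ContDiff ℝ 1 w) (i : Fin d)
    (x v : Space d) : fderiv ℝ (fun x => w x i) x v = fderiv ℝ w x v i := by
  have h := (EuclideanSpace.proj (𝕜 := ℝ) i).hasFDerivAt.comp x
    (hw.differentiable one_ne_zero x).hasFDerivAt
  have h' : HasFDerivAt (fun x => w x i) _ x := h
  rw [h'.fderiv]
  rfl

/-- This supplies the measurability of the approximating normal components, about which
`HasNormalTrace` says nothing. -/
theorem integrable_inner_outwardNormal {d : ℕ} {Ω : Set (Space d)} (hΩ : IsOpen Ω)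
    (hLip : HasLipschitzBoundary Ω) {w : Space d → Space d} (hw : ContDiff ℝ 1 w)
    (hwc : HasCompactSupport w) :
    Integrable (fun x => ⟪w x, outwardNormal Ω x⟫_ℝ) (surfaceMeasure Ω) := by
  simp_rw [inner_eq_sum_mul_inner_single (w _)]
  exact integrable_finsetSum _ fun i _ =>
    (gaussGreen_of_contDiff hΩ hLip (contDiff_coord hw i) (hasCompactSupport_coord hwc i) _).1

theorem continuous_divergence {d : ℕ} {w : Space d → Space d} (hw : ContDiff ℝ 1 w) :
    Continuous (divergence w) := by
  have h : divergence w = fun x => ∑ i : Fin d,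
      fderiv ℝ (fun x => w x i) x (EuclideanSpace.single i 1) := by
    ext x
    simp_rw [fderiv_coord hw, divergence]
  rw [h]
  exact continuous_finsetSum _ fun i _ =>
    ((contDiff_coord hw i).continuous_fderiv one_ne_zero).clm_apply continuous_const

theorem continuous_gradient {d : ℕ} {u : Space d → ℝ} (hu : ContDiff ℝ 1 u) :
    Continuous (gradient u) :=
  (InnerProductSpace.toDual ℝ (Space d)).symm.continuous.comp (hu.continuous_fderiv one_ne_zero)

theorem setIntegral_mul_divergence_add_inner_gradient {d : ℕ} {Ω : Set (Space d)} (hΩ : IsOpen Ω)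
    (hLip : HasLipschitzBoundary Ω) {u : Space d → ℝ} (hu : ContDiff ℝ 1 u)
    {w : Space d → Space d} (hw : ContDiff ℝ 1 w) (hwc : HasCompactSupport w) :
    ∫ x in Ω, (u x * divergence w x + ⟪gradient u x, w x⟫_ℝ) =
      ∫ x, u x * ⟪w x, outwardNormal Ω x⟫_ℝ ∂(surfaceMeasure Ω) := by
  have hd : ∀ i, ContDiff ℝ 1 fun x => u x * w x i := fun i => hu.mul (contDiff_coord hw i)
  have hc : ∀ i, HasCompactSupport fun x => u x * w x i := fun i =>
    (hasCompactSupport_coord hwc i).mul_left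
  have hG := fun i => gaussGreen_of_contDiff hΩ hLip (hd i) (hc i) (EuclideanSpace.single i 1)
  have h1 : ∀ x, u x * divergence w x + ⟪gradient u x, w x⟫_ℝ =
      ∑ i, fderiv ℝ (fun x => u x * w x i) x (EuclideanSpace.single i 1) := fun x => by
    rw [real_inner_comm, inner_eq_sum_mul_inner_single, divergence, Finset.mul_sum,
      ← Finset.sum_add_distrib]
    refine Finset.sum_congr rfl fun i _ => ?_
    rw [fderiv_fun_mul (hu.differentiable one_ne_zero x)
      ((contDiff_coord hw i).differentiable one_ne_zero x), ← fderiv_coord hw, real_inner_comm,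
      inner_gradient_left]
    rfl
  simp_rw [h1, inner_eq_sum_mul_inner_single (w _), Finset.mul_sum, ← mul_assoc]
  rw [integral_finsetSum _ fun i _ => integrable_fderiv_apply (hd i) (hc i) _,
    integral_finsetSum _ fun i _ => (hG i).1]
  exact Finset.sum_congr rfl fun i _ => (hG i).2

/-! ### Passage to the limit -/

/-- Continuity of the Hölder pairing along sequences. -/
theorem tendsto_integral_bilin {α E F : Type*} [MeasurableSpace α] {μ : Measure α}
    [NormedAddCommGroup E] [NormedSpace ℝ E] [NormedAddCommGroup F] [NormedSpace ℝ F]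
    (B : E →L[ℝ] F →L[ℝ] ℝ) {p q : ℝ≥0∞} [ENNReal.HolderTriple p q 1] (hq : 1 ≤ q)
    {f : α → E} {g : α → F} (hf : MemLp f p μ) (hg : MemLp g q μ)
    {f' : ℕ → α → E} {g' : ℕ → α → F} (hf' : ∀ k, AEStronglyMeasurable (f' k) μ)
    (hg' : ∀ k, AEStronglyMeasurable (g' k) μ)
    (hfl : Tendsto (fun k => eLpNorm (fun x => f' k x - f x) p μ) atTop (𝓝 0))
    (hgl : Tendsto (fun k => eLpNorm (fun x => g' k x - g x) q μ) atTop (𝓝 0)) :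
    (∀ᶠ k in atTop, Integrable (fun x => B (f' k x) (g' k x)) μ) ∧
    Tendsto (fun k => ∫ x, B (f' k x) (g' k x) ∂μ) atTop (𝓝 (∫ x, B (f x) (g x) ∂μ)) := by
  have hB : ∀ a b, ‖B a b‖₊ ≤ ‖B‖₊ * ‖a‖₊ * ‖b‖₊ := fun a b => B.le_opNorm₂ a b
  have hmeas : ∀ {a : α → E} {b : α → F}, AEStronglyMeasurable a μ → AEStronglyMeasurable b μ →
      AEStronglyMeasurable (fun x => B (a x) (b x)) μ := fun ha hb =>
    (B.continuous₂).comp_aestronglyMeasurable₂ ha hb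
  have hint : ∀ {a : α → E} {b : α → F}, MemLp a p μ → MemLp b q μ →
      Integrable (fun x => B (a x) (b x)) μ := fun ha hb =>
    memLp_one_iff_integrable.1 (MemLp.of_bilin (fun a b => B a b) ‖B‖₊ ha hb
      (hmeas ha.1 hb.1) (ae_of_all _ fun x => hB _ _))
  have hfd : ∀ᶠ k in atTop, MemLp (fun x => f' k x - f x) p μ :=
    (hfl.eventually (gt_mem_nhds ENNReal.zero_lt_top)).mono fun k hk => ⟨(hf' k).sub hf.1, hk⟩
  have hgd : ∀ᶠ k in atTop, MemLp (fun x => g' k x - g x) q μ :=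
    (hgl.eventually (gt_mem_nhds ENNReal.zero_lt_top)).mono fun k hk => ⟨(hg' k).sub hg.1, hk⟩
  have hev : ∀ᶠ k in atTop, Integrable (fun x => B (f' k x) (g' k x)) μ := by
    filter_upwards [hfd, hgd] with k h1 h2
    have := hint (h1.add hf) (h2.add hg)
    simpa using this
  refine ⟨hev, tendsto_integral_of_L1' _ (hmeas hf.1 hg.1) hev ?_⟩
  set bound : ℕ → ℝ≥0∞ := fun k =>
    ‖B‖₊ * eLpNorm (fun x => f' k x - f x) p μ *
        (eLpNorm (fun x => g' k x - g x) q μ + eLpNorm g q μ) +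
      ‖B‖₊ * eLpNorm f p μ * eLpNorm (fun x => g' k x - g x) q μ with hbound
  have hlim : Tendsto bound atTop (𝓝 0) := by
    have h1 : Tendsto (fun k => ‖B‖₊ * eLpNorm (fun x => f' k x - f x) p μ) atTop
        (𝓝 ((‖B‖₊ : ℝ≥0∞) * 0)) := ENNReal.Tendsto.const_mul hfl (Or.inr ENNReal.coe_ne_top)
    have h2 := hgl.add (tendsto_const_nhds (x := eLpNorm g q μ))
    have h3 := ENNReal.Tendsto.mul h1 (Or.inr (by simpa using hg.2.ne)) h2 (Or.inr (by simp))
    have h4 : Tendsto (fun k => ‖B‖₊ * eLpNorm f p μ * eLpNorm (fun x => g' k x - g x) q μ) atTop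
        (𝓝 ((‖B‖₊ : ℝ≥0∞) * eLpNorm f p μ * 0)) :=
      ENNReal.Tendsto.const_mul hgl (Or.inr (ENNReal.mul_ne_top ENNReal.coe_ne_top hf.2.ne))
    simpa [hbound] using h3.add h4
  refine tendsto_of_tendsto_of_tendsto_of_le_of_le tendsto_const_nhds hlim (fun _ => zero_le) ?_
  intro k
  have hsplit : ((fun x => B (f' k x) (g' k x)) - fun x => B (f x) (g x)) =
      (fun x => B (f' k x - f x) (g' k x)) + fun x => B (f x) (g' k x - g x) := by
    ext x
    simp only [Pi.sub_apply, Pi.add_apply, map_sub, sub_apply]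
    ring
  have hgk : eLpNorm (g' k) q μ ≤ eLpNorm (fun x => g' k x - g x) q μ + eLpNorm g q μ := by
    have := eLpNorm_add_le (μ := μ) ((hg' k).sub hg.1) hg.1 hq
    rwa [sub_add_cancel] at this
  have m1 : AEStronglyMeasurable (fun x => f' k x - f x) μ := (hf' k).sub hf.1
  have m2 : AEStronglyMeasurable (fun x => g' k x - g x) μ := (hg' k).sub hg.1
  simp only [hsplit]
  refine (eLpNorm_add_le (hmeas m1 (hg' k)) (hmeas hf.1 m2) le_rfl).trans (add_le_add ?_ ?_)
  · refine (eLpNorm_le_eLpNorm_mul_eLpNorm_of_nnnorm (p := p) (q := q) m1 (hg' k)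
      (fun a b => B a b) ‖B‖₊ (ae_of_all _ fun x => hB _ _)).trans ?_
    exact mul_le_mul_right hgk _
  · exact eLpNorm_le_eLpNorm_mul_eLpNorm_of_nnnorm (p := p) (q := q) hf.1 m2
      (fun a b => B a b) ‖B‖₊ (ae_of_all _ fun x => hB _ _)

/-- **Green's formula** for functions with traces. -/
theorem setIntegral_eq_integral_trace_mul_normalTrace {d : ℕ} {Ω : Set (Space d)} (hΩ : IsOpen Ω)
    (hLip : HasLipschitzBoundary Ω) {p q : ℝ≥0∞} (hpq : ENNReal.HolderConjugate p q)
    {P : Space d → ℝ} {G v : Space d → Space d} {D g h : Space d → ℝ}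
    (hP : MemLp P 2 (volume.restrict Ω)) (hG : MemLp G 2 (volume.restrict Ω))
    (hv : MemLp v 2 (volume.restrict Ω)) (hD : MemLp D 2 (volume.restrict Ω))
    (hg : HasTrace Ω q P G g) (hh : HasNormalTrace Ω p v D h) :
    (∫ x in Ω, P x * D x) + ∫ x in Ω, ⟪G x, v x⟫_ℝ = ∫ x, g x * h x ∂(surfaceMeasure Ω) := by
  obtain ⟨hgL, u, hu, huP, huG, hug⟩ := hg
  obtain ⟨hhL, w, hw, hwv, hwD, hwh⟩ := hh
  have hqp : ENNReal.HolderConjugate q p := hpq.symm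
  have t1 := tendsto_integral_bilin (ContinuousLinearMap.mul ℝ ℝ) (p := 2) (q := 2)
    one_le_two hP hD
    (fun k => (hu k).1.continuous.aestronglyMeasurable)
    (fun k => (continuous_divergence (hw k).1).aestronglyMeasurable) huP hwD
  have t2 := tendsto_integral_bilin (innerSL ℝ (E := Space d)) (p := 2) (q := 2)
    one_le_two hG hv
    (fun k => (continuous_gradient (hu k).1).aestronglyMeasurable)
    (fun k => (hw k).1.continuous.aestronglyMeasurable) huG hwv
  have t3 := tendsto_integral_bilin (ContinuousLinearMap.mul ℝ ℝ) (p := q) (q := p)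
    hpq.one_le hgL hhL
    (fun k => (hu k).1.continuous.aestronglyMeasurable)
    (fun k => (integrable_inner_outwardNormal hΩ hLip (hw k).1 (hw k).2).1) hug hwh
  refine tendsto_nhds_unique ((t1.2.add t2.2).congr' ?_) t3.2
  filter_upwards [t1.1, t2.1] with k h1 h2
  rw [← integral_add h1 h2]
  exact setIntegral_mul_divergence_add_inner_gradient hΩ hLip (hu k).1 (hw k).1 (hw k).2

/-! ### The reciprocal relation -/

theorem inner_matAct_comm {d : ℕ} {A : Matrix (Fin d) (Fin d) ℝ} (hA : A.IsSymm) (x y : Space d) :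
    ⟪matAct A x, y⟫_ℝ = ⟪matAct A y, x⟫_ℝ := by
  have h : A.IsHermitian := by
    rw [Matrix.IsHermitian, Matrix.conjTranspose_eq_transpose_of_trivial]; exact hA
  rw [real_inner_comm x]
  exact Matrix.isSymmetric_toEuclideanLin_iff.2 h x y

/-- By Green's formula both sides are interior integrals `∫ ∇Pᵢ • vⱼ`, and these agree because
Darcy's law turns them into `-∫ μ vᵢ • K⁻¹ vⱼ`, which is symmetric in the two solutions. -/
theorem integral_trace_mul_normalTrace_comm {d : ℕ} {Ω Γp Γv : Set (Space d)} (hΩ : IsOpen Ω)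
    (hLip : HasLipschitzBoundary Ω) {μ : Space d → ℝ} {K : Space d → Matrix (Fin d) (Fin d) ℝ}
    (hK : ∀ x ∈ Ω, (K x).IsSymm) {p q : ℝ≥0∞} (hpq : ENNReal.HolderConjugate p q)
    {vn₁ Pp₁ vn₂ Pp₂ : Space d → ℝ} {v₁ v₂ : Space d → Space d}
    {P₁ P₂ vB₁ PB₁ vB₂ PB₂ : Space d → ℝ}
    (h₁ : IsDarcySolution Ω Γp Γv μ K p q vn₁ Pp₁ v₁ P₁ vB₁ PB₁)
    (h₂ : IsDarcySolution Ω Γp Γv μ K p q vn₂ Pp₂ v₂ P₂ vB₂ PB₂) :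
    ∫ x, PB₁ x * vB₂ x ∂(surfaceMeasure Ω) = ∫ x, PB₂ x * vB₁ x ∂(surfaceMeasure Ω) := by
  obtain ⟨G₁, hG₁, ht₁, he₁⟩ := h₁.momentum
  obtain ⟨G₂, hG₂, ht₂, he₂⟩ := h₂.momentum
  have g₁ := setIntegral_eq_integral_trace_mul_normalTrace hΩ hLip hpq hG₁.memLp hG₁.memLp_grad
    h₂.div_eq_zero.memLp h₂.div_eq_zero.memLp_div ht₁ h₂.normal_trace
  have g₂ := setIntegral_eq_integral_trace_mul_normalTrace hΩ hLip hpq hG₂.memLp hG₂.memLp_grad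
    h₁.div_eq_zero.memLp h₁.div_eq_zero.memLp_div ht₂ h₁.normal_trace
  rw [← g₁, ← g₂]
  simp only [mul_zero, integral_zero, zero_add]
  refine integral_congr_ae ?_
  filter_upwards [he₁, he₂, ae_restrict_mem hΩ.measurableSet] with x h1 h2 hx
  rw [eq_neg_of_add_eq_zero_right h1, eq_neg_of_add_eq_zero_right h2, inner_neg_left,
    inner_neg_left, inner_smul_left, inner_smul_left, inner_matAct_comm (hK x hx).inv]

theorem mainTheorem6 {d : ℕ} (hd : 1 ≤ d)
    (Ω : Set (Space d)) (hΩ : IsOpen Ω) (hLip : HasLipschitzBoundary Ω)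
    (Γp Γv : Set (Space d)) (hΓp : MeasurableSet Γp) (hΓv : MeasurableSet Γv)
    (hunion : Γp ∪ Γv = frontier Ω) (hdisj : Disjoint Γp Γv)
    (μ : Space d → ℝ) (hμ : ∀ x ∈ Ω, 0 < μ x)
    (K : Space d → Matrix (Fin d) (Fin d) ℝ) (hK : IsPermeability Ω K)
    (p q : ℝ≥0∞) (hpq : ENNReal.HolderConjugate p q)
    (vn₁ Pp₁ vn₂ Pp₂ : Space d → ℝ)
    (v₁ v₂ : Space d → Space d) (P₁ P₂ : Space d → ℝ)
    (vB₁ PB₁ vB₂ PB₂ : Space d → ℝ)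
    (h₁ : IsDarcySolution Ω Γp Γv μ K p q vn₁ Pp₁ v₁ P₁ vB₁ PB₁)
    (h₂ : IsDarcySolution Ω Γp Γv μ K p q vn₂ Pp₂ v₂ P₂ vB₂ PB₂) :
    (IntegrableOn (fun x => vn₂ x * PB₁ x) Γv (surfaceMeasure Ω) ∧
      IntegrableOn (fun x => Pp₂ x * vB₁ x) Γp (surfaceMeasure Ω) ∧
      IntegrableOn (fun x => vn₁ x * PB₂ x) Γv (surfaceMeasure Ω) ∧
      IntegrableOn (fun x => Pp₁ x * vB₂ x) Γp (surfaceMeasure Ω)) ∧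
    (∫ x in Γv, vn₂ x * PB₁ x ∂(surfaceMeasure Ω))
        - (∫ x in Γp, Pp₂ x * vB₁ x ∂(surfaceMeasure Ω))
      = (∫ x in Γv, vn₁ x * PB₂ x ∂(surfaceMeasure Ω))
        - (∫ x in Γp, Pp₁ x * vB₂ x ∂(surfaceMeasure Ω)) := by
  have hqp : ENNReal.HolderTriple q p 1 := hpq.symm
  have hPB₁ : MemLp PB₁ q (surfaceMeasure Ω) := h₁.momentum.choose_spec.2.1.1
  have hPB₂ : MemLp PB₂ q (surfaceMeasure Ω) := h₂.momentum.choose_spec.2.1.1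
  have hi₁ : Integrable (fun x => PB₁ x * vB₂ x) (surfaceMeasure Ω) :=
    hPB₁.integrable_mul h₂.normal_trace.1
  have hi₂ : Integrable (fun x => PB₂ x * vB₁ x) (surfaceMeasure Ω) :=
    hPB₂.integrable_mul h₁.normal_trace.1
  have a₁ : (fun x => vn₂ x * PB₁ x) =ᵐ[(surfaceMeasure Ω).restrict Γv]
      fun x => PB₁ x * vB₂ x := by
    filter_upwards [h₂.velocity_bc] with x hx
    rw [hx, mul_comm]
  have a₂ : (fun x => Pp₂ x * vB₁ x) =ᵐ[(surfaceMeasure Ω).restrict Γp]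
      fun x => PB₂ x * vB₁ x := by
    filter_upwards [h₂.pressure_bc] with x hx
    rw [hx]
  have a₃ : (fun x => vn₁ x * PB₂ x) =ᵐ[(surfaceMeasure Ω).restrict Γv]
      fun x => PB₂ x * vB₁ x := by
    filter_upwards [h₁.velocity_bc] with x hx
    rw [hx, mul_comm]
  have a₄ : (fun x => Pp₁ x * vB₂ x) =ᵐ[(surfaceMeasure Ω).restrict Γp]
      fun x => PB₁ x * vB₂ x := by
    filter_upwards [h₁.pressure_bc] with x hx
    rw [hx]
  refine ⟨⟨hi₁.integrableOn.congr a₁.symm, hi₂.integrableOn.congr a₂.symm,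
    hi₂.integrableOn.congr a₃.symm, hi₁.integrableOn.congr a₄.symm⟩, ?_⟩
  have hsplit : ∀ g : Space d → ℝ, Integrable g (surfaceMeasure Ω) →
      ∫ x, g x ∂(surfaceMeasure Ω) = (∫ x in Γp, g x ∂(surfaceMeasure Ω)) +
        ∫ x in Γv, g x ∂(surfaceMeasure Ω) := fun g hg => by
    rw [← setIntegral_union hdisj hΓv hg.integrableOn hg.integrableOn, hunion, surfaceMeasure,
      Measure.restrict_restrict isClosed_frontier.measurableSet, Set.inter_self]
  have hrec := integral_trace_mul_normalTrace_comm hΩ hLip hK.1 hpq h₁ h₂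
  rw [hsplit _ hi₁, hsplit _ hi₂] at hrec
  rw [integral_congr_ae a₁, integral_congr_ae a₂, integral_congr_ae a₃, integral_congr_ae a₄]
  linarith
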